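/- Let $X$ be the double heptagon: two regular heptagons $H$ and $-H$, where $H$ is centred at the origin and has one vertical side, with each side of $H$ glued by a translation to the parallel opposite side of $-H$. The singularities of $X$ are the images of the vertices. The Veech group $\Gamma\subset SL_2(\mathbb R)$ of $X$ is the group of derivatives (of determinant $1$) of the homeomorphisms of $X$ that preserve the singularities and are affine with constant derivative, in the translation charts, away from them. The trace field $K$ of $X$ is the subfield of $\mathbb R$ generated by the traces of the elements of $\Gamma$. An element of $\Gamma$ is hyperbolic if the absolute value of its trace is greater than $2$, and a direction (a line through the origin of $\mathbb R^2$) is hyperbolic if it is fixed by a hyperbolic element of $\Gamma$. Slopes are measured in the coordinates $(x,y)$ of the staircase model of $X$, in which $(x,y)$ stands for the vector $T\binom{x}{y}$ of the original plane, where $$T=\begin{pmatrix}\cos\frac{\pi}{7}+1&\cos\frac{\pi}{7}+1\\-\sin\frac{\pi}{7}&\sin\frac{\pi}{7}\end{pmatrix}$$ (the columns of $T$ are parallel to two sides of the heptagon). Then there are hyperbolic directions of $X$ whose slopes lie in $K$. Explicitly, let $a=2\cos\frac{\pi}{7}$ and $$M=\begin{pmatrix}a&1\\a^2-1&a\end{pmatrix}\begin{pmatrix}a&1\\a^2-1&a\end{pmatrix}\begin{pmatrix}1&0\\a&1\end{pmatrix}\begin{pmatrix}1&a\\0&1\end{pmatrix}\begin{pmatrix}a&-1\\-a^2+1&a\end{pmatrix}\begin{pmatrix}a&-1\\-a^2+1&a\end{pmatrix}.$$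 For each of these factors $A$, the matrix $TAT^{-1}$ belongs to $\Gamma$; moreover $\operatorname{tr}M=2+a^2$, so that $TMT^{-1}$ is a hyperbolic element of $\Gamma$, and $M$ fixes two distinct directions, of slopes $m_1\neq m_2$ in $K$. That is, the directions of $T\binom{1}{m_1}$ and $T\binom{1}{m_2}$ are hyperbolic directions of $X$. -/

import Mathlib

open Topology
open scoped MatrixGroups

/-- The linear action of a real `2 × 2` matrix of determinant one on the plane `ℂ = ℝ²`. -/
def planeAct (A : SL(2, ℝ)) (z : ℂ) : ℂ :=
  ⟨A 0 0 * z.re + A 0 1 * z.im, A 1 0 * z.re + A 1 1 * z.im⟩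

theorem planeAct_one (z : ℂ) : planeAct 1 z = z := by
  apply Complex.ext <;> simp [planeAct]

theorem planeAct_mul (A B : SL(2, ℝ)) (z : ℂ) :
    planeAct (A * B) z = planeAct A (planeAct B z) := by
  apply Complex.ext <;>
    simp [planeAct, Matrix.mul_apply, Fin.sum_univ_two] <;> ring

/-- A translation structure on a space `X`, with finitely many singularities: charts with values in
the plane, covering exactly the complement of the singular set, all of whose transition functions
are (locally) translations. -/
structure TranslationStructure (X : Type*) [TopologicalSpace X] where
  /-- the singularities -/
  singular : Set X
  finite_singular : singular.Finite
  /-- the charts -/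
  atlas : Set (OpenPartialHomeomorph X ℂ)
  covers : ∀ p : X, p ∉ singular ↔ ∃ φ ∈ atlas, p ∈ φ.source
  transition : ∀ φ ∈ atlas, ∀ ψ ∈ atlas, ∀ p ∈ φ.source, p ∈ ψ.source →
    ∀ᶠ q in 𝓝 p, ψ q - ψ p = φ q - φ p

namespace TranslationStructure

variable {X : Type*} [TopologicalSpace X]

/-- `f` is an affine diffeomorphism with derivative `A`: a homeomorphism of `X` which preserves the
singular set (hence its complement) and which, in translation charts around any nonsingular point
and its image, is an affine map with linear part `A`. -/
def IsAffine (S : TranslationStructure X) (f : X ≃ₜ X) (A : SL(2, ℝ)) : Prop :=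
  (∀ p, f p ∈ S.singular ↔ p ∈ S.singular) ∧
  ∀ φ ∈ S.atlas, ∀ ψ ∈ S.atlas, ∀ p ∈ φ.source, f p ∈ ψ.source →
    ∀ᶠ q in 𝓝 p, ψ (f q) - ψ (f p) = planeAct A (φ q - φ p)

/-- The Veech group: all derivatives (of determinant one) of affine diffeomorphisms. -/
def veechGroup (S : TranslationStructure X) : Subgroup SL(2, ℝ) where
  carrier := {A | ∃ f : X ≃ₜ X, S.IsAffine f A}
  one_mem' := by
    refine ⟨Homeomorph.refl X, fun p => Iff.rfl, fun φ hφ ψ hψ p hp hq => ?_⟩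
    filter_upwards [S.transition φ hφ ψ hψ p hp hq] with q h
    simpa [planeAct_one] using h
  mul_mem' := by
    rintro A B ⟨f, hf, hfA⟩ ⟨g, hg, hgB⟩
    refine ⟨g.trans f, fun p => (hf (g p)).trans (hg p), fun φ hφ ψ hψ p hp hq => ?_⟩
    have hgp : g p ∉ S.singular := by
      rw [hg]; exact (S.covers p).2 ⟨φ, hφ, hp⟩
    obtain ⟨χ, hχ, hχp⟩ := (S.covers (g p)).1 hgp
    filter_upwards [hgB φ hφ χ hχ p hp hχp,
      g.continuous.continuousAt.eventually (hfA χ hχ ψ hψ (g p) hχp hq)] with q h1 h2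
    simp only [Homeomorph.trans_apply]
    rw [h2, h1, planeAct_mul]
  inv_mem' := by
    rintro A ⟨f, hf, hfA⟩
    refine ⟨f.symm, fun p => ?_, fun φ hφ ψ hψ p hp hq => ?_⟩
    · rw [← hf, f.apply_symm_apply]
    · have h := hfA ψ hψ φ hφ (f.symm p) hq (by simpa using hp)
      filter_upwards [f.symm.continuous.continuousAt.eventually h] with q h
      simp only [Homeomorph.apply_symm_apply] at h
      rw [h, ← planeAct_mul, inv_mul_cancel, planeAct_one]

end TranslationStructure

/-- An element of `SL(2, ℝ)` is hyperbolic if its trace has absolute value greater than `2`. -/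
def IsHyperbolicElement (A : SL(2, ℝ)) : Prop :=
  2 < |(A : Matrix (Fin 2) (Fin 2) ℝ).trace|

/-- The vector `v` spans a direction (a line through the origin) that is fixed by the matrix `A`. -/
def FixesDirection (A : Matrix (Fin 2) (Fin 2) ℝ) (v : Fin 2 → ℝ) : Prop :=
  v ≠ 0 ∧ ∃ c : ℝ, A.mulVec v = c • v

/-- A hyperbolic direction of `Γ`: one that is fixed by a hyperbolic element of `Γ`. -/
def IsHyperbolicDirection (Γ : Subgroup SL(2, ℝ)) (v : Fin 2 → ℝ) : Prop :=
  ∃ A ∈ Γ, IsHyperbolicElement A ∧ FixesDirection (A : Matrix (Fin 2) (Fin 2) ℝ) v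

/-- The trace field of `Γ`: the subfield of `ℝ` generated by the traces of the elements of `Γ`. -/
noncomputable def traceField (Γ : Subgroup SL(2, ℝ)) : IntermediateField ℚ ℝ :=
  IntermediateField.adjoin ℚ
    {t : ℝ | ∃ A ∈ Γ, t = (A : Matrix (Fin 2) (Fin 2) ℝ).trace}

namespace DoubleHeptagon

/-- The Euclidean scalar product of the plane. -/
def dot (u z : ℂ) : ℝ := u.re * z.re + u.im * z.im

/-- The closed regular heptagon centred at `0` with inradius `1` whose sides have as outer unit
normals the seventh roots of unity; in particular one side, on the line `re z = 1`, is vertical. -/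
def heptagon : Set ℂ := {z | ∀ u : ℂ, u ^ 7 = 1 → dot u z ≤ 1}

/-- The opposite heptagon, `-heptagon`. -/
def oppHeptagon : Set ℂ := {z | ∀ u : ℂ, u ^ 7 = 1 → -1 ≤ dot u z}

/-- The disjoint union of the two closed heptagons. -/
abbrev Pieces : Type := heptagon ⊕ oppHeptagon

/-- The gluing: the side with outer normal `u` of the first heptagon is glued to the parallel side,
with outer normal `-u`, of the second one, by the translation by `-2 * u`. -/
inductive Glue : Pieces → Pieces → Prop
  | mk (u : ℂ) (hu : u ^ 7 = 1) (z : heptagon) (w : oppHeptagon) (hz : dot u z = 1)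
      (hw : (w : ℂ) = z - 2 * u) : Glue (Sum.inl z) (Sum.inr w)

/-- Vertices of the two heptagons: the points that lie on two different sides. -/
def IsVertex : Pieces → Prop
  | Sum.inl z => ∃ u v : ℂ, u ^ 7 = 1 ∧ v ^ 7 = 1 ∧ u ≠ v ∧ dot u z = 1 ∧ dot v z = 1
  | Sum.inr z => ∃ u v : ℂ, u ^ 7 = 1 ∧ v ^ 7 = 1 ∧ u ≠ v ∧ dot u z = -1 ∧ dot v z = -1

/-- The double heptagon: two regular heptagons with their parallel opposite sides glued together,
with the quotient topology. -/
def Surface : Type := Quot Glue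

instance : TopologicalSpace Surface := inferInstanceAs (TopologicalSpace (Quot Glue))

/-- The image in the surface of a point of one of the two heptagons. -/
def proj (x : Pieces) : Surface := Quot.mk Glue x

theorem continuous_proj : Continuous proj := continuous_quot_mk

theorem isOpen_surface {s : Set Surface} : IsOpen s ↔ IsOpen (proj ⁻¹' s) := Iff.rfl

theorem continuous_dot (u : ℂ) : Continuous (dot u) := by
  unfold dot; fun_prop

theorem finite_roots : {u : ℂ | u ^ 7 = 1}.Finite := by
  have h : {u : ℂ | u ^ 7 = 1} = (Polynomial.nthRootsFinset 7 (1 : ℂ) : Set ℂ) := by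
    ext u; simp
  rw [h]; exact Finset.finite_toSet _

theorem norm_root {u : ℂ} (hu : u ^ 7 = 1) : u.re ^ 2 + u.im ^ 2 = 1 := by
  have h : ‖u‖ = 1 := Complex.norm_eq_one_of_pow_eq_one hu (by norm_num)
  have h2 := Complex.sq_norm u
  rw [h, Complex.normSq_apply] at h2
  linarith

/-- Mirror image of the normal `v` in the axis spanned by the unit vector `u`. -/
noncomputable def mirror (u v : ℂ) : ℂ := u ^ 2 * (starRingEnd ℂ) v

theorem mirror_pow {u v : ℂ} (hu : u ^ 7 = 1) (hv : v ^ 7 = 1) : mirror u v ^ 7 = 1 := by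
  rw [mirror, mul_pow, ← map_pow, hv, ← pow_mul, mul_comm 2 7, pow_mul, hu]; simp

theorem mirror_mirror {u v : ℂ} (hu : u ^ 7 = 1) : mirror u (mirror u v) = v := by
  have h := norm_root hu
  have h1 : u * (starRingEnd ℂ) u = 1 := by
    rw [Complex.mul_conj, Complex.normSq_apply]; norm_cast; linarith
  simp only [mirror, map_mul, map_pow, Complex.conj_conj]
  calc _ = (u * (starRingEnd ℂ) u) ^ 2 * v := by ring
    _ = v := by rw [h1]; ring

theorem mirror_self {u : ℂ} (hu : u ^ 7 = 1) : mirror u u = u := by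
  have h := norm_root hu
  have h1 : u * (starRingEnd ℂ) u = 1 := by
    rw [Complex.mul_conj, Complex.normSq_apply]; norm_cast; linarith
  calc mirror u u = u * (u * (starRingEnd ℂ) u) := by unfold mirror; ring
    _ = u := by rw [h1, mul_one]

theorem mirror_ne {u v : ℂ} (hu : u ^ 7 = 1) (hne : v ≠ u) : mirror u v ≠ u := by
  intro h
  apply hne
  rw [← mirror_mirror (v := v) hu, h, mirror_self hu]

theorem dot_sub {u z : ℂ} (hu : u ^ 7 = 1) : dot u (z - 2 * u) = dot u z - 2 := by
  have h := norm_root hu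
  simp [dot]; nlinarith

theorem dot_mirror {u v z : ℂ} (hu : u ^ 7 = 1) (hz : dot u z = 1) :
    dot v (z - 2 * u) = - dot (mirror u v) z := by
  have h := norm_root hu
  simp only [dot, mirror] at *
  simp [pow_two]
  linear_combination
    -(v.re * z.re + v.im * z.im) * h + 2 * (u.re * v.re + u.im * v.im) * hz

theorem Glue.isVertex_iff {x y : Pieces} (h : Glue x y) : IsVertex x ↔ IsVertex y := by
  obtain ⟨u, hu, z, w, hz, hw⟩ := h
  have huw : dot u w = -1 := by rw [hw, dot_sub hu, hz]; norm_num
  constructor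
  · rintro ⟨s, t, hs, ht, hst, hsz, htz⟩
    have key : ∀ r : ℂ, r ^ 7 = 1 → r ≠ u → dot r z = 1 → IsVertex (Sum.inr w) := by
      intro r hr hru hrz
      refine ⟨u, mirror u r, hu, mirror_pow hu hr, (mirror_ne hu hru).symm, huw, ?_⟩
      rw [hw, dot_mirror hu hz, mirror_mirror hu, hrz]
    by_cases hsu : s = u
    · exact key t ht (fun h => hst (hsu.trans h.symm)) htz
    · exact key s hs hsu hsz
  · rintro ⟨s, t, hs, ht, hst, hsw, htw⟩
    have key : ∀ r : ℂ, r ^ 7 = 1 → r ≠ u → dot r w = -1 → IsVertex (Sum.inl z) := by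
      intro r hr hru hrw
      refine ⟨u, mirror u r, hu, mirror_pow hu hr, (mirror_ne hu hru).symm, hz, ?_⟩
      rw [hw, dot_mirror hu hz] at hrw
      linarith
    by_cases hsu : s = u
    · exact key t ht (fun h => hst (hsu.trans h.symm)) htw
    · exact key s hs hsu hsw

theorem glue_unique_right {x y y' : Pieces} (hx : ¬ IsVertex x) (h : Glue x y) (h' : Glue x y') :
    y = y' := by
  obtain ⟨u, hu, z, w, hz, hw⟩ := h
  rcases h' with ⟨v, hv, _, w', hz', hw'⟩
  have huv : u = v := by
    by_contra hne
    exact hx ⟨u, v, hu, hv, hne, hz, hz'⟩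
  subst huv
  rw [Subtype.ext (hw.trans hw'.symm)]

theorem glue_unique_left {x x' y : Pieces} (hy : ¬ IsVertex y) (h : Glue x y) (h' : Glue x' y) :
    x = x' := by
  obtain ⟨u, hu, z, w, hz, hw⟩ := h
  rcases h' with ⟨v, hv, z', _, hz', hw'⟩
  have huv : u = v := by
    by_contra hne
    refine hy ⟨u, v, hu, hv, hne, ?_, ?_⟩
    · rw [hw, dot_sub hu, hz]; norm_num
    · rw [hw', dot_sub hv, hz']; norm_num
  subst huv
  have : (z : ℂ) = z' := sub_left_injective (hw.symm.trans hw')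
  rw [Subtype.ext this]

theorem not_glue_glue {x y z : Pieces} (h : Glue x y) (h' : Glue y z) : False := by
  cases h; cases h'

theorem eqvGen_glue {x y : Pieces} (h : Relation.EqvGen Glue x y) :
    (IsVertex x ↔ IsVertex y) ∧ (¬ IsVertex x → x = y ∨ Glue x y ∨ Glue y x) := by
  induction h with
  | rel x y h => exact ⟨h.isVertex_iff, fun _ => Or.inr (Or.inl h)⟩
  | refl x => exact ⟨Iff.rfl, fun _ => Or.inl rfl⟩
  | symm x y _ ih =>
    refine ⟨ih.1.symm, fun hy => ?_⟩
    rcases ih.2 (fun hx => hy (ih.1.1 hx)) with h | h | h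
    · exact Or.inl h.symm
    · exact Or.inr (Or.inr h)
    · exact Or.inr (Or.inl h)
  | trans x y z _ _ ih1 ih2 =>
    refine ⟨ih1.1.trans ih2.1, fun hx => ?_⟩
    have hy : ¬ IsVertex y := fun hy => hx (ih1.1.2 hy)
    rcases ih1.2 hx with h1 | h1 | h1
    · subst h1; exact ih2.2 hx
    · rcases ih2.2 hy with h2 | h2 | h2
      · subst h2; exact Or.inr (Or.inl h1)
      · exact (not_glue_glue h1 h2).elim
      · exact Or.inl (glue_unique_left hy h1 h2)
    · rcases ih2.2 hy with h2 | h2 | h2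
      · subst h2; exact Or.inr (Or.inr h1)
      · exact Or.inl (glue_unique_right hy h1 h2)
      · exact (not_glue_glue h2 h1).elim

theorem proj_eq {x y : Pieces} (h : proj x = proj y) :
    (IsVertex x ↔ IsVertex y) ∧ (¬ IsVertex x → x = y ∨ Glue x y ∨ Glue y x) :=
  eqvGen_glue (Quot.eqvGen_exact h)

theorem inl_eq_inl {z w : heptagon} (hz : ¬ IsVertex (Sum.inl z))
    (h : proj (Sum.inl z) = proj (Sum.inl w)) : z = w := by
  rcases (proj_eq h).2 hz with h | h | h
  · exact Sum.inl_injective h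
  · cases h
  · cases h

theorem inr_eq_inr {z w : oppHeptagon} (hz : ¬ IsVertex (Sum.inr z))
    (h : proj (Sum.inr z) = proj (Sum.inr w)) : z = w := by
  rcases (proj_eq h).2 hz with h | h | h
  · exact Sum.inr_injective h
  · cases h
  · cases h

theorem inl_eq_inr {z : heptagon} {w : oppHeptagon} (hz : ¬ IsVertex (Sum.inl z))
    (h : proj (Sum.inl z) = proj (Sum.inr w)) :
    ∃ u : ℂ, u ^ 7 = 1 ∧ dot u z = 1 ∧ (w : ℂ) = z - 2 * u := by
  rcases (proj_eq h).2 hz with h | h | h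
  · cases h
  · cases h with
    | mk u hu z w hz hw => exact ⟨u, hu, hz, hw⟩
  · cases h

/-- The singularities of the double heptagon: the images of the vertices. -/
def singularSet : Set Surface := proj '' {x | IsVertex x}

theorem finite_singularSet : singularSet.Finite := by
  refine Set.Finite.image _ ?_
  have key : ∀ (c : ℝ) (u v z : ℂ), u ^ 7 = 1 → v ^ 7 = 1 → u ≠ v → dot u z = c → dot v z = c →
      z = (starRingEnd ℂ) (2 * c / (u + v)) := by
    intro c u v z hu hv huv h1 h2
    have nu := norm_root hu
    have nv := norm_root hv
    have hsum : u + v ≠ 0 := by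
      intro h
      have : u = -v := eq_neg_of_add_eq_zero_left h
      rw [this, Odd.neg_pow (by decide), hv] at hu
      norm_num at hu
    have e : ∀ w : ℂ, w.re ^ 2 + w.im ^ 2 = 1 → dot w z = c →
        z + (starRingEnd ℂ) z * w ^ 2 = 2 * c * w := by
      intro w hw h
      simp only [dot] at h
      apply Complex.ext
      · simp [pow_two]
        linear_combination 2 * w.re * h - z.re * hw
      · simp [pow_two]
        linear_combination 2 * w.im * h - z.im * hw
    have e1 := e u nu h1
    have e2 := e v nv h2
    have e3 : (u - v) * ((starRingEnd ℂ) z * (u + v) - 2 * c) = 0 := by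
      linear_combination e1 - e2
    have e4 : (starRingEnd ℂ) z * (u + v) = 2 * c :=
      sub_eq_zero.1 ((mul_eq_zero.1 e3).resolve_left (sub_ne_zero.2 huv))
    rw [← Complex.conj_conj z, ← e4, mul_div_cancel_right₀ _ hsum]
  have hfin : ∀ c : ℝ, ((fun p : ℂ × ℂ => (starRingEnd ℂ) (2 * c / (p.1 + p.2))) ''
      ({u : ℂ | u ^ 7 = 1} ×ˢ {u : ℂ | u ^ 7 = 1})).Finite :=
    fun c => (finite_roots.prod finite_roots).image _
  have f1 := ((hfin 1).preimage (f := fun z : heptagon => (z : ℂ))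
    Subtype.val_injective.injOn).image (Sum.inl : heptagon → Pieces)
  have f2 := ((hfin (-1)).preimage (f := fun z : oppHeptagon => (z : ℂ))
    Subtype.val_injective.injOn).image (Sum.inr : oppHeptagon → Pieces)
  refine (f1.union f2).subset ?_
  rintro (z | z) ⟨u, v, hu, hv, huv, h1, h2⟩
  · exact Or.inl ⟨z, ⟨(u, v), ⟨hu, hv⟩, (key 1 u v z hu hv huv h1 h2).symm⟩, rfl⟩
  · exact Or.inr ⟨z, ⟨(u, v), ⟨hu, hv⟩, (key (-1) u v z hu hv huv h1 h2).symm⟩, rfl⟩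

/-- The plane region obtained by placing next to the heptagon, across its side with normal `u`, the
translated opposite heptagon, and removing all other sides. -/
def dom (u : ℂ) : Set ℂ :=
  {z | ∀ v : ℂ, v ^ 7 = 1 → v ≠ u →
    (dot u z ≤ 1 → dot v z < 1) ∧ (1 ≤ dot u z → -1 < dot v (z - 2 * u))}

theorem isOpen_dom (u : ℂ) : IsOpen (dom u) := by
  have h : dom u = ⋂ v ∈ {v : ℂ | v ^ 7 = 1}, {z | v ≠ u →
    (dot u z ≤ 1 → dot v z < 1) ∧ (1 ≤ dot u z → -1 < dot v (z - 2 * u))} := by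
    ext z; simp [dom]
  rw [h]
  refine finite_roots.isOpen_biInter fun v _ => ?_
  by_cases hvu : v = u
  · simp [hvu]
  have h1 : IsClosed {z | dot u z ≤ 1 ∧ 1 ≤ dot v z} :=
    (isClosed_le (continuous_dot u) continuous_const).inter
      (isClosed_le continuous_const (continuous_dot v))
  have h2 : IsClosed {z | 1 ≤ dot u z ∧ dot v (z - 2 * u) ≤ -1} :=
    (isClosed_le continuous_const (continuous_dot u)).inter
      (isClosed_le ((continuous_dot v).comp (continuous_id.sub continuous_const)) continuous_const)
  convert h1.isOpen_compl.inter h2.isOpen_compl using 1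
  ext z
  simp [hvu]

theorem mem_left {u z : ℂ} (hz : z ∈ dom u) (h : dot u z ≤ 1) : z ∈ heptagon := by
  intro v hv
  by_cases hvu : v = u
  · rwa [hvu]
  · exact ((hz v hv hvu).1 h).le

theorem mem_right {u z : ℂ} (hu : u ^ 7 = 1) (hz : z ∈ dom u) (h : 1 ≤ dot u z) :
    z - 2 * u ∈ oppHeptagon := by
  intro v hv
  by_cases hvu : v = u
  · rw [hvu, dot_sub hu]; linarith
  · exact ((hz v hv hvu).2 h).le

theorem zero_mem : (0 : ℂ) ∈ heptagon := fun u _ => by simp [dot]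

open Classical in
/-- Inverse of the chart around the side with normal `u`: it sends a point of the region `dom u` to
the point of the surface that it represents. -/
noncomputable def param (u z : ℂ) : Surface :=
  if h : dot u z ≤ 1 ∧ z ∈ heptagon then proj (Sum.inl ⟨z, h.2⟩)
  else if h : z - 2 * u ∈ oppHeptagon then proj (Sum.inr ⟨z - 2 * u, h⟩)
  else proj (Sum.inl ⟨0, zero_mem⟩)

theorem param_left {u z : ℂ} (hz : z ∈ heptagon) (h : dot u z ≤ 1) :
    param u z = proj (Sum.inl ⟨z, hz⟩) := by
  rw [param, dif_pos ⟨h, hz⟩]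

theorem param_right {u z : ℂ} (hu : u ^ 7 = 1) (hz : z - 2 * u ∈ oppHeptagon) (h : 1 ≤ dot u z) :
    param u z = proj (Sum.inr ⟨z - 2 * u, hz⟩) := by
  by_cases h1 : dot u z ≤ 1 ∧ z ∈ heptagon
  · rw [param, dif_pos h1]
    exact Quot.sound (Glue.mk u hu _ _ (le_antisymm h1.1 h) rfl)
  · rw [param, dif_neg h1, dif_pos hz]

theorem not_isVertex_left {u z : ℂ} (hz : z ∈ dom u) (h : dot u z ≤ 1) (hz' : z ∈ heptagon) :
    ¬ IsVertex (Sum.inl ⟨z, hz'⟩) := by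
  rintro ⟨s, t, hs, ht, hst, h1, h2⟩
  by_cases hsu : s = u
  · have := (hz t ht (fun h => hst (hsu.trans h.symm))).1 h
    exact this.ne h2
  · exact ((hz s hs hsu).1 h).ne h1

theorem not_isVertex_right {u z : ℂ} (hz : z ∈ dom u) (h : 1 ≤ dot u z)
    (hz' : z - 2 * u ∈ oppHeptagon) : ¬ IsVertex (Sum.inr ⟨z - 2 * u, hz'⟩) := by
  rintro ⟨s, t, hs, ht, hst, h1, h2⟩
  by_cases hsu : s = u
  · have := (hz t ht (fun h => hst (hsu.trans h.symm))).2 h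
    exact this.ne' h2
  · exact ((hz s hs hsu).2 h).ne' h1

/-- A point of the first heptagon is parametrized only by itself. -/
theorem eq_of_proj_inl {u w : ℂ} (hu : u ^ 7 = 1) (hw : w ∈ dom u) {z : heptagon}
    (h : proj (Sum.inl z) = param u w) : (z : ℂ) = w := by
  rcases le_total (dot u w) 1 with h1 | h1
  · rw [param_left (mem_left hw h1) h1] at h
    exact congrArg Subtype.val (inl_eq_inl (not_isVertex_left hw h1 _) h.symm).symm
  · rw [param_right hu (mem_right hu hw h1) h1] at h
    have hv : ¬ IsVertex (Sum.inl z) := fun hv =>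
      not_isVertex_right hw h1 (mem_right hu hw h1) ((proj_eq h).1.1 hv)
    obtain ⟨v, hv7, hvz, he⟩ := inl_eq_inr hv h
    simp only at he
    have hvu : v = u := by
      by_contra hvu
      have h2 := (hw v hv7 hvu).2 h1
      rw [he, dot_sub hv7, hvz] at h2
      norm_num at h2
    rw [hvu] at he
    exact (sub_left_injective he).symm

/-- A point of the second heptagon is parametrized only by its translate. -/
theorem eq_of_proj_inr {u w : ℂ} (hu : u ^ 7 = 1) (hw : w ∈ dom u) {z : oppHeptagon}
    (h : proj (Sum.inr z) = param u w) : (z : ℂ) + 2 * u = w := by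
  rcases le_total (dot u w) 1 with h1 | h1
  · rw [param_left (mem_left hw h1) h1] at h
    obtain ⟨v, hv7, hvz, he⟩ := inl_eq_inr (not_isVertex_left hw h1 _) h.symm
    simp only at he hvz
    have hvu : v = u := by
      by_contra hvu
      exact ((hw v hv7 hvu).1 h1).ne hvz
    rw [he, hvu]; ring
  · rw [param_right hu (mem_right hu hw h1) h1] at h
    have := congrArg Subtype.val (inr_eq_inr (not_isVertex_right hw h1 _) h.symm)
    simp only at this
    rw [← this]; ring

theorem injOn_param {u : ℂ} (hu : u ^ 7 = 1) : Set.InjOn (param u) (dom u) := by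
  intro z hz w hw h
  rcases le_total (dot u z) 1 with h1 | h1
  · rw [param_left (mem_left hz h1) h1] at h
    exact eq_of_proj_inl hu hw h
  · rw [param_right hu (mem_right hu hz h1) h1] at h
    rw [← eq_of_proj_inr hu hw h]; ring

theorem continuousOn_param {u : ℂ} (hu : u ^ 7 = 1) : ContinuousOn (param u) (dom u) := by
  have hL : ContinuousOn (param u) (heptagon ∩ {z | dot u z ≤ 1}) := by
    rw [continuousOn_iff_continuous_domRestrict]
    have h : (heptagon ∩ {z | dot u z ≤ 1}).domRestrict (param u) =
        fun z => proj (Sum.inl ⟨z.1, z.2.1⟩) := by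
      funext z; exact param_left z.2.1 z.2.2
    rw [h]
    exact continuous_proj.comp (continuous_inl.comp (continuous_subtype_val.subtype_mk _))
  have hR : ContinuousOn (param u) ({z | z - 2 * u ∈ oppHeptagon} ∩ {z | 1 ≤ dot u z}) := by
    rw [continuousOn_iff_continuous_domRestrict]
    have h : ({z | z - 2 * u ∈ oppHeptagon} ∩ {z | 1 ≤ dot u z}).domRestrict (param u) =
        fun z => proj (Sum.inr ⟨z.1 - 2 * u, z.2.1⟩) := by
      funext z; exact param_right hu z.2.1 z.2.2
    rw [h]
    exact continuous_proj.comp (continuous_inr.comp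
      ((continuous_subtype_val.sub continuous_const).subtype_mk _))
  have hept : IsClosed heptagon := by
    have : heptagon = ⋂ u : ℂ, ⋂ _ : u ^ 7 = 1, {z | dot u z ≤ 1} := by
      ext z; simp [heptagon]
    rw [this]
    exact isClosed_iInter fun u => isClosed_iInter fun _ =>
      isClosed_le (continuous_dot u) continuous_const
  have hopp : IsClosed oppHeptagon := by
    have : oppHeptagon = ⋂ u : ℂ, ⋂ _ : u ^ 7 = 1, {z | -1 ≤ dot u z} := by
      ext z; simp [oppHeptagon]
    rw [this]
    exact isClosed_iInter fun u => isClosed_iInter fun _ =>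
      isClosed_le continuous_const (continuous_dot u)
  refine (hL.union_of_isClosed hR ?_ ?_).mono ?_
  · exact hept.inter (isClosed_le (continuous_dot u) continuous_const)
  · exact (hopp.preimage (continuous_id.sub continuous_const)).inter
      (isClosed_le continuous_const (continuous_dot u))
  · intro z hz
    rcases le_total (dot u z) 1 with h1 | h1
    · exact Or.inl ⟨mem_left hz h1, h1⟩
    · exact Or.inr ⟨mem_right hu hz h1, h1⟩

theorem isOpen_image_param {u : ℂ} (hu : u ^ 7 = 1) {W : Set ℂ} (hW : IsOpen W)
    (hWd : W ⊆ dom u) : IsOpen (param u '' W) := by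
  rw [isOpen_surface, isOpen_sum_iff]
  constructor
  · convert hW.preimage (continuous_subtype_val (p := (· ∈ heptagon))) using 1
    ext z
    constructor
    · rintro ⟨w, hw, h⟩
      have := eq_of_proj_inl hu (hWd hw) h.symm
      rw [Set.mem_preimage, this]; exact hw
    · intro hz
      rcases le_total (dot u z) 1 with h1 | h1
      · exact ⟨z, hz, param_left z.2 h1⟩
      · exact ⟨z, hz, param_left z.2 (z.2 u hu)⟩
  · convert hW.preimage ((continuous_subtype_val (p := (· ∈ oppHeptagon))).add
      (continuous_const (y := 2 * u))) using 1
    ext z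
    constructor
    · rintro ⟨w, hw, h⟩
      have := eq_of_proj_inr hu (hWd hw) h.symm
      change (z : ℂ) + 2 * u ∈ W
      rw [this]; exact hw
    · intro hz
      refine ⟨z + 2 * u, hz, ?_⟩
      have h1 := dot_sub (z := (z : ℂ) + 2 * u) hu
      rw [add_sub_cancel_right] at h1
      have h2 := z.2 u hu
      rw [param_right hu (by rw [add_sub_cancel_right]; exact z.2) (by linarith)]
      simp only [add_sub_cancel_right]

theorem isOpenMap_param {u : ℂ} (hu : u ^ 7 = 1) :
    IsOpenMap ((dom u).domRestrict (param u)) := by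
  intro W hW
  have h := isOpen_image_param hu ((isOpen_dom u).isOpenMap_subtype_val W hW)
    (by rintro _ ⟨z, _, rfl⟩; exact z.2)
  rw [Set.image_image] at h
  exact h

/-- The inverse chart around the side with normal `u`, as a partial homeomorphism. -/
noncomputable def invChart (u : ℂ) (hu : u ^ 7 = 1) : OpenPartialHomeomorph ℂ Surface :=
  OpenPartialHomeomorph.ofContinuousOpenRestrict
    ((injOn_param hu).bijOn_image.toPartialEquiv (param u) (dom u) (param u '' dom u))
    (continuousOn_param hu)
    (isOpenMap_param hu)
    (isOpen_dom u)

theorem invChart_apply {u : ℂ} (hu : u ^ 7 = 1) (z : ℂ) : invChart u hu z = param u z := rfl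

theorem invChart_source {u : ℂ} (hu : u ^ 7 = 1) : (invChart u hu).source = dom u := rfl

theorem invChart_target {u : ℂ} (hu : u ^ 7 = 1) :
    (invChart u hu).target = param u '' dom u := rfl

theorem covers {p : Surface} (hp : p ∉ singularSet) :
    ∃ u : ℂ, u ^ 7 = 1 ∧ p ∈ param u '' dom u := by
  obtain ⟨x, rfl⟩ : ∃ x, proj x = p := Quot.exists_rep p
  have hx : ¬ IsVertex x := fun h => hp ⟨x, h, rfl⟩
  rcases x with z | z
  · obtain ⟨u, hu, huz⟩ : ∃ u : ℂ, u ^ 7 = 1 ∧ ∀ v : ℂ, v ^ 7 = 1 → v ≠ u → dot v z ≠ 1 := by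
      by_cases h : ∃ u : ℂ, u ^ 7 = 1 ∧ dot u z = 1
      · obtain ⟨u, hu, huz⟩ := h
        exact ⟨u, hu, fun v hv hvu hvz => hx ⟨v, u, hv, hu, hvu, hvz, huz⟩⟩
      · exact ⟨1, one_pow 7, fun v hv _ hvz => h ⟨v, hv, hvz⟩⟩
    refine ⟨u, hu, z, ?_, param_left z.2 (z.2 u hu)⟩
    intro v hv hvu
    refine ⟨fun _ => lt_of_le_of_ne (z.2 v hv) (huz v hv hvu), fun h1 => ?_⟩
    have h2 : dot u z = 1 := le_antisymm (z.2 u hu) h1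
    rw [dot_mirror hu h2]
    have h3 := lt_of_le_of_ne (z.2 _ (mirror_pow hu hv))
      (huz _ (mirror_pow hu hv) (mirror_ne hu hvu))
    linarith
  · obtain ⟨u, hu, huz⟩ : ∃ u : ℂ, u ^ 7 = 1 ∧ ∀ v : ℂ, v ^ 7 = 1 → v ≠ u → dot v z ≠ -1 := by
      by_cases h : ∃ u : ℂ, u ^ 7 = 1 ∧ dot u z = -1
      · obtain ⟨u, hu, huz⟩ := h
        exact ⟨u, hu, fun v hv hvu hvz => hx ⟨v, u, hv, hu, hvu, hvz, huz⟩⟩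
      · exact ⟨1, one_pow 7, fun v hv _ hvz => h ⟨v, hv, hvz⟩⟩
    have h0 := dot_sub (z := (z : ℂ) + 2 * u) hu
    rw [add_sub_cancel_right] at h0
    have hzu := z.2 u hu
    have hlt : ∀ v : ℂ, v ^ 7 = 1 → v ≠ u → -1 < dot v z := fun v hv hvu =>
      lt_of_le_of_ne (z.2 v hv) (huz v hv hvu).symm
    refine ⟨u, hu, z + 2 * u, ?_, ?_⟩
    · intro v hv hvu
      refine ⟨fun h1 => ?_, fun _ => ?_⟩
      · have h2 : dot u ((z : ℂ) + 2 * u) = 1 := by linarith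
        have h3 := dot_mirror (v := mirror u v) hu h2
        rw [add_sub_cancel_right, mirror_mirror hu] at h3
        have h4 := hlt _ (mirror_pow hu hv) (mirror_ne hu hvu)
        linarith
      · rw [add_sub_cancel_right]; exact hlt v hv hvu
    · rw [param_right hu (by rw [add_sub_cancel_right]; exact z.2) (by linarith)]
      simp only [add_sub_cancel_right]

theorem param_notMem_singularSet {u z : ℂ} (hu : u ^ 7 = 1) (hz : z ∈ dom u) :
    param u z ∉ singularSet := by
  rintro ⟨x, hx, h⟩
  rcases le_total (dot u z) 1 with h1 | h1
  · rw [param_left (mem_left hz h1) h1] at h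
    exact not_isVertex_left hz h1 _ ((proj_eq h).1.1 hx)
  · rw [param_right hu (mem_right hu hz h1) h1] at h
    exact not_isVertex_right hz h1 _ ((proj_eq h).1.1 hx)

theorem change_left {u v w : ℂ} (hv : v ^ 7 = 1) (huv : u ≠ v) (hw : w ∈ dom u)
    (h : dot u w < 1) : w ∈ dom v ∧ param v w = param u w := by
  have hvw : dot v w < 1 := (hw v hv huv.symm).1 h.le
  have hm := mem_left hw h.le
  refine ⟨fun t ht htv => ⟨fun _ => ?_, fun h1 => absurd hvw (not_lt.2 h1)⟩, ?_⟩
  · by_cases htu : t = u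
    · rwa [htu]
    · exact (hw t ht htu).1 h.le
  · rw [param_left hm hvw.le, param_left hm h.le]

theorem change_right {u v w : ℂ} (hu : u ^ 7 = 1) (hv : v ^ 7 = 1) (huv : u ≠ v) (hw : w ∈ dom u)
    (h : 1 < dot u w) :
    w - 2 * u + 2 * v ∈ dom v ∧ param v (w - 2 * u + 2 * v) = param u w := by
  have hvw : -1 < dot v (w - 2 * u) := (hw v hv huv.symm).2 h.le
  have hm := mem_right hu hw h.le
  have e : w - 2 * u + 2 * v - 2 * v = w - 2 * u := add_sub_cancel_right _ _
  have h1 : 1 < dot v (w - 2 * u + 2 * v) := by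
    have := dot_sub (z := w - 2 * u + 2 * v) hv
    rw [e] at this
    linarith
  refine ⟨fun t ht htv => ⟨fun h2 => absurd h1 (not_lt.2 h2), fun _ => ?_⟩, ?_⟩
  · rw [e]
    by_cases htu : t = u
    · rw [htu, dot_sub hu]; linarith
    · exact (hw t ht htu).2 h.le
  · rw [param_right hu hm h.le, param_right hv (by rw [e]; exact hm) h1.le]
    simp only [e]

theorem change_side {u v z w : ℂ} (hu : u ^ 7 = 1) (hv : v ^ 7 = 1) (hz : z ∈ dom u)
    (hw : w ∈ dom v) (h : dot u z = 1) (he : param v w = param u z) : u = v := by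
  by_contra huv
  have hm := mem_left hz h.le
  have h1 := he
  rw [param_left hm h.le] at h1
  have e1 : z = w := eq_of_proj_inl hv hw h1.symm
  rw [param_right hu (mem_right hu hz h.ge) h.ge] at he
  have e2 : z - 2 * u + 2 * v = w := eq_of_proj_inr hv hw he.symm
  apply huv
  have : (2 : ℂ) * (u - v) = 0 := by rw [← e1] at e2; linear_combination -e2
  exact sub_eq_zero.1 ((mul_eq_zero.1 this).resolve_left two_ne_zero)

theorem transition {u v : ℂ} (hu : u ^ 7 = 1) (hv : v ^ 7 = 1) (p : Surface)
    (hp : p ∈ (invChart u hu).target) (hq : p ∈ (invChart v hv).target) :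
    ∀ᶠ q in 𝓝 p, (invChart v hv).symm q - (invChart v hv).symm p =
      (invChart u hu).symm q - (invChart u hu).symm p := by
  by_cases huv : u = v
  · subst huv; exact Filter.Eventually.of_forall fun _ => rfl
  set φ := (invChart u hu).symm with hφ
  set ψ := (invChart v hv).symm with hψ
  have hz : φ p ∈ dom u := (invChart u hu).map_target hp
  have hw : ψ p ∈ dom v := (invChart v hv).map_target hq
  have hzp : param u (φ p) = p := (invChart u hu).right_inv hp
  have hwp : param v (ψ p) = p := (invChart v hv).right_inv hq
  have hcont : ContinuousAt φ p := (invChart u hu).symm.continuousAt hp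
  have htar : ∀ᶠ q in 𝓝 p, q ∈ (invChart u hu).target :=
    (invChart u hu).open_target.mem_nhds hp
  have inv : ∀ x ∈ dom v, ψ (param v x) = x := fun x hx => (invChart v hv).left_inv hx
  rcases lt_trichotomy (dot u (φ p)) 1 with h | h | h
  · have L : ∀ q ∈ (invChart u hu).target, dot u (φ q) < 1 → ψ q = φ q := by
      intro q hq hlt
      have h1 := change_left hv huv ((invChart u hu).map_target hq) hlt
      have h2 : param u (φ q) = q := (invChart u hu).right_inv hq
      have h3 := inv _ h1.1
      rw [h1.2] at h3
      rwa [h2] at h3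
    have hev : ∀ᶠ q in 𝓝 p, dot u (φ q) < 1 :=
      ((continuous_dot u).continuousAt.comp hcont).eventually_lt continuousAt_const h
    filter_upwards [htar, hev] with q h1 h2
    rw [L q h1 h2, L p hp h]
  · exact (huv (change_side hu hv hz hw h (hwp.trans hzp.symm))).elim
  · have R : ∀ q ∈ (invChart u hu).target, 1 < dot u (φ q) → ψ q = φ q - 2 * u + 2 * v := by
      intro q hq hlt
      have h1 := change_right hu hv huv ((invChart u hu).map_target hq) hlt
      have h2 : param u (φ q) = q := (invChart u hu).right_inv hq
      have h3 := inv _ h1.1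
      rw [h1.2] at h3
      rwa [h2] at h3
    have hev : ∀ᶠ q in 𝓝 p, 1 < dot u (φ q) :=
      continuousAt_const.eventually_lt ((continuous_dot u).continuousAt.comp hcont) h
    filter_upwards [htar, hev] with q h1 h2
    rw [R q h1 h2, R p hp h]
    ring

/-- The translation structure of the double heptagon. -/
noncomputable def structureOn : TranslationStructure Surface where
  singular := singularSet
  finite_singular := finite_singularSet
  atlas := {φ | ∃ (u : ℂ) (hu : u ^ 7 = 1), φ = (invChart u hu).symm}
  covers p := by
    constructor
    · intro hp
      obtain ⟨u, hu, h⟩ := covers hp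
      exact ⟨_, ⟨u, hu, rfl⟩, h⟩
    · rintro ⟨_, ⟨u, hu, rfl⟩, z, hz, rfl⟩
      exact param_notMem_singularSet hu hz
  transition := by
    rintro _ ⟨u, hu, rfl⟩ _ ⟨v, hv, rfl⟩ p hp hq
    exact transition hu hv p hp hq

/-- The Veech group of the double heptagon. -/
noncomputable def veechGroup : Subgroup SL(2, ℝ) := structureOn.veechGroup

end DoubleHeptagon

/-!
The Veech group of the double heptagon contains the derivatives of two kinds of explicit affine
homeomorphisms, and these already generate all the matrices in question.

*Rotations.* For `η ^ 7 = -1`, multiplication by `η` exchanges the two heptagons and respects the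
gluing, so that the rotation by `π/7` belongs to the group (`rotMatrix_mem`).

*The multi-twist.* The vertical lines through the vertices (`wall`) cut the heptagon into two
trapezoids and a triangle. Each piece of `heptagon`, together with the opposite piece of
`oppHeptagon`, forms a vertical cylinder: a strip between two walls modulo a vertical translation.
All three cylinders have the same ratio `2 cot (π/7)` of circumference to width
(`slope_mul_width`), so the vertical shear of this slope turns each of them exactly once, fixes their
boundaries pointwise, and descends to the surface. The parametrization `cyl j` of the cylinder by the
strip is defined on the whole strip, with the period built in, and hence the twist can be described
by the single formula `twist_cyl` without cutting the sheared pieces up again. The twist is affine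
inside of the cylinders because `cyl j` is locally inverse to a chart (`isParamAt_cyl`). Near a
nonsingular point of a wall the shears on the two sides differ by a full turn of one cylinder, and
hence agree (`cyl_shear_left`). The central symmetry commutes with the twist, so that it is enough to
look at the first heptagon. The result is `twistMatrix_mem`.

*Algebra.* In staircase coordinates the rotation by `π/7` becomes `!![0, -1; 1, a]`, and a conjugate
of the inverse multi-twist becomes `U`; these two generate `P`, `L` and `Q`. The matrix `M` is
conjugate to `L * U`, whose characteristic polynomial has discriminant `a ^ 2 * (a ^ 2 + 4)`. By the
cubic equation of `a = 2 cos (π/7)` this is a square in `ℚ(a)`, so that both fixed slopes are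
polynomials in `a`; and `a` is itself a trace, namely of the rotation by `π/7`.
-/

namespace DoubleHeptagon

/-! ### The heptagon cut along the vertical lines through its vertices -/

theorem cos_pos : 0 < Real.cos (Real.pi / 7) :=
  Real.cos_pos_of_mem_Ioo ⟨by linarith [Real.pi_pos], by linarith [Real.pi_pos]⟩

theorem sin_pos : 0 < Real.sin (Real.pi / 7) :=
  Real.sin_pos_of_pos_of_lt_pi (by linarith [Real.pi_pos]) (by linarith [Real.pi_pos])

/-- Cosine of the argument `2mπ/7` of the `m`-th outer normal. -/
noncomputable def co (m : ℕ) : ℝ := Real.cos (m * (2 * (Real.pi / 7)))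

/-- Sine of the argument `2mπ/7` of the `m`-th outer normal. -/
noncomputable def si (m : ℕ) : ℝ := Real.sin (m * (2 * (Real.pi / 7)))

/-- The outer normal of argument `2mπ/7`. For `m ≤ 3` these normals and their complex conjugates
are all the outer normals of the heptagon. -/
noncomputable def normal (m : ℕ) : ℂ := ⟨co m, si m⟩

/-- The abscissa of the two vertices of the heptagon of arguments `±(2m+1)π/7`. -/
noncomputable def wall (m : ℕ) : ℝ :=
  Real.cos ((2 * m + 1) * (Real.pi / 7)) / Real.cos (Real.pi / 7)

theorem co_sq_add_si_sq (m : ℕ) : co m ^ 2 + si m ^ 2 = 1 := by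
  rw [co, si]; exact Real.cos_sq_add_sin_sq _

theorem co_zero : co 0 = 1 := by simp [co]

theorem si_zero : si 0 = 0 := by simp [si]

theorem si_pos {m : ℕ} (h0 : 0 < m) (h : m ≤ 3) : 0 < si m := by
  have h1 : (1 : ℝ) ≤ m := by exact_mod_cast h0
  have h2 : (m : ℝ) ≤ 3 := by exact_mod_cast h
  have := Real.pi_pos
  exact Real.sin_pos_of_pos_of_lt_pi (by positivity) (by nlinarith)

theorem si_nonneg {m : ℕ} (h : m ≤ 3) : 0 ≤ si m := by
  rcases Nat.eq_zero_or_pos m with rfl | h0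
  · rw [si_zero]
  · exact (si_pos h0 h).le

theorem normal_eq_exp (m : ℕ) :
    normal m = Complex.exp (2 * Real.pi * Complex.I / 7) ^ m := by
  rw [← Complex.exp_nat_mul]
  have : (m : ℂ) * (2 * Real.pi * Complex.I / 7) =
      ((m * (2 * (Real.pi / 7)) : ℝ) : ℂ) * Complex.I := by push_cast; ring
  rw [this]
  apply Complex.ext
  · rw [Complex.exp_ofReal_mul_I_re]; rfl
  · rw [Complex.exp_ofReal_mul_I_im]; rfl

theorem normal_pow (m : ℕ) : normal m ^ 7 = 1 := by
  have h := (Complex.isPrimitiveRoot_exp 7 (by norm_num)).pow_eq_one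
  rw [normal_eq_exp, pow_right_comm]
  rw [show (Complex.exp (2 * Real.pi * Complex.I / 7)) ^ 7 = 1 by exact_mod_cast h, one_pow]

theorem conj_pow {u : ℂ} (hu : u ^ 7 = 1) : (starRingEnd ℂ) u ^ 7 = 1 := by
  rw [← map_pow, hu, map_one]

theorem eq_normal {u : ℂ} (hu : u ^ 7 = 1) :
    ∃ m ≤ 3, u = normal m ∨ u = (starRingEnd ℂ) (normal m) := by
  have h := Complex.isPrimitiveRoot_exp 7 (by norm_num)
  obtain ⟨i, hi, rfl⟩ := h.eq_pow_of_pow_eq_one hu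
  have e : (Complex.exp (2 * Real.pi * Complex.I / (7 : ℕ))) ^ i = normal i := by
    rw [normal_eq_exp]; norm_cast
  rw [e]
  by_cases h3 : i ≤ 3
  · exact ⟨i, h3, Or.inl rfl⟩
  · refine ⟨7 - i, by omega, Or.inr ?_⟩
    have e2 : ((7 - i : ℕ) : ℝ) * (2 * (Real.pi / 7)) = 2 * Real.pi - i * (2 * (Real.pi / 7)) := by
      rw [Nat.cast_sub hi.le]; push_cast; ring
    apply Complex.ext
    · simp only [normal, co, Complex.conj_re]
      rw [e2, Real.cos_two_pi_sub]
    · simp only [normal, si, Complex.conj_im]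
      rw [e2, Real.sin_two_pi_sub, neg_neg]

theorem dot_normal (m : ℕ) (z : ℂ) : dot (normal m) z = co m * z.re + si m * z.im := rfl

theorem dot_conj_normal (m : ℕ) (z : ℂ) :
    dot ((starRingEnd ℂ) (normal m)) z = co m * z.re - si m * z.im := by
  simp [dot, normal]; ring

theorem dot_neg (u z : ℂ) : dot u (-z) = -dot u z := by
  simp [dot]; ring

/-- The larger of the scalar products of `z` with the `m`-th normal and with its conjugate. -/
noncomputable def level (m : ℕ) (z : ℂ) : ℝ := co m * z.re + si m * |z.im|

theorem level_le_iff {m : ℕ} (hm : m ≤ 3) {z : ℂ} {c : ℝ} :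
    level m z ≤ c ↔ dot (normal m) z ≤ c ∧ dot ((starRingEnd ℂ) (normal m)) z ≤ c := by
  have hs := si_nonneg hm
  rw [dot_normal, dot_conj_normal, level]
  constructor
  · intro h
    constructor
    · nlinarith [le_abs_self z.im]
    · nlinarith [neg_abs_le z.im]
  · rintro ⟨h1, h2⟩
    rcases abs_cases z.im with ⟨h, _⟩ | ⟨h, _⟩ <;> rw [h] <;> linarith

theorem level_lt_iff {m : ℕ} (hm : m ≤ 3) {z : ℂ} {c : ℝ} :
    level m z < c ↔ dot (normal m) z < c ∧ dot ((starRingEnd ℂ) (normal m)) z < c := by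
  have hs := si_nonneg hm
  rw [dot_normal, dot_conj_normal, level]
  constructor
  · intro h
    constructor
    · nlinarith [le_abs_self z.im]
    · nlinarith [neg_abs_le z.im]
  · rintro ⟨h1, h2⟩
    rcases abs_cases z.im with ⟨h, _⟩ | ⟨h, _⟩ <;> rw [h] <;> linarith

theorem mem_heptagon_iff {z : ℂ} : z ∈ heptagon ↔ ∀ m ≤ 3, level m z ≤ 1 := by
  constructor
  · intro h m hm
    exact (level_le_iff hm).2 ⟨h _ (normal_pow m), h _ (conj_pow (normal_pow m))⟩
  · intro h u hu
    obtain ⟨m, hm, rfl | rfl⟩ := eq_normal hu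
    · exact ((level_le_iff hm).1 (h m hm)).1
    · exact ((level_le_iff hm).1 (h m hm)).2

theorem neg_mem_heptagon_iff {z : ℂ} : -z ∈ heptagon ↔ z ∈ oppHeptagon := by
  refine forall₂_congr fun u _ => ?_
  rw [dot_neg]; exact neg_le

theorem si_one_eq (m : ℕ) : si 1 = si (m + 1) * co m - co (m + 1) * si m := by
  simp only [si, co]
  rw [← Real.sin_sub]; congr 1; push_cast; ring

/-- Two consecutive side lines of the upper half of the heptagon meet above the wall between
them: the left one lies below the right one exactly to the left of that wall. -/
theorem level_step (m : ℕ) (z : ℂ) :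
    si (m + 1) * (1 - level m z) =
      si m * (1 - level (m + 1) z) + si 1 * (wall m - z.re) := by
  have e1 := si_one_eq m
  have e2 : si 1 * wall m = si (m + 1) - si m := by
    have h : si 1 = 2 * Real.sin (Real.pi / 7) * Real.cos (Real.pi / 7) := by
      rw [si, Nat.cast_one, one_mul, Real.sin_two_mul]
    rw [h, wall, si, si, Real.sin_sub_sin]
    have h1 : (((m + 1 : ℕ) : ℝ) * (2 * (Real.pi / 7)) - m * (2 * (Real.pi / 7))) / 2 =
        Real.pi / 7 := by push_cast; ring
    have h2 : (((m + 1 : ℕ) : ℝ) * (2 * (Real.pi / 7)) + m * (2 * (Real.pi / 7))) / 2 =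
        (2 * m + 1) * (Real.pi / 7) := by push_cast; ring
    rw [h1, h2]
    field_simp [cos_pos.ne']
  unfold level
  linear_combination (-z.re) * e1 - e2 + 2 * z.re * e1

theorem level_le_of_succ {m : ℕ} (hm : m < 3) {z : ℂ} (hz : z.re ≤ wall m)
    (h : level (m + 1) z ≤ 1) : level m z ≤ 1 := by
  have h1 := level_step m z
  have h2 := si_pos (Nat.succ_pos m) hm
  have h3 := si_nonneg hm.le
  have h4 := si_pos one_pos (by norm_num)
  have : 0 ≤ si (m + 1) * (1 - level m z) := by
    rw [h1]; exact add_nonneg (mul_nonneg h3 (by linarith)) (mul_nonneg h4.le (by linarith))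
  nlinarith [(mul_nonneg_iff_of_pos_left h2).1 this]

theorem level_lt_of_succ {m : ℕ} (hm : m < 3) {z : ℂ} (hz : z.re < wall m)
    (h : level (m + 1) z ≤ 1) : level m z < 1 := by
  have h1 := level_step m z
  have h2 := si_pos (Nat.succ_pos m) hm
  have h3 := si_nonneg hm.le
  have h4 := si_pos one_pos (by norm_num)
  have : 0 < si (m + 1) * (1 - level m z) := by
    rw [h1]; exact add_pos_of_nonneg_of_pos (mul_nonneg h3 (by linarith)) (mul_pos h4 (by linarith))
  linarith [(mul_pos_iff_of_pos_left h2).1 this]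

theorem level_succ_le {m : ℕ} (h0 : 0 < m) (hm : m < 3) {z : ℂ} (hz : wall m ≤ z.re)
    (h : level m z ≤ 1) : level (m + 1) z ≤ 1 := by
  have h1 := level_step m z
  have h2 := si_pos (Nat.succ_pos m) hm
  have h3 := si_pos h0 hm.le
  have h4 := si_pos one_pos (by norm_num)
  have : 0 ≤ si m * (1 - level (m + 1) z) := by
    have a1 := mul_nonneg h2.le (sub_nonneg.2 h)
    have a2 := mul_nonneg h4.le (sub_nonneg.2 hz)
    linarith
  linarith [(mul_nonneg_iff_of_pos_left h3).1 this]

theorem level_succ_lt {m : ℕ} (h0 : 0 < m) (hm : m < 3) {z : ℂ} (hz : wall m < z.re)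
    (h : level m z ≤ 1) : level (m + 1) z < 1 := by
  have h1 := level_step m z
  have h2 := si_pos (Nat.succ_pos m) hm
  have h3 := si_pos h0 hm.le
  have h4 := si_pos one_pos (by norm_num)
  have : 0 < si m * (1 - level (m + 1) z) := by
    have a1 := mul_nonneg h2.le (sub_nonneg.2 h)
    have a2 := mul_pos h4 (sub_pos.2 hz)
    linarith
  linarith [(mul_pos_iff_of_pos_left h3).1 this]

theorem wall_zero : wall 0 = 1 := by
  simp [wall, cos_pos.ne']

theorem wall_three_mul_cos : wall 3 * Real.cos (Real.pi / 7) = -1 := by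
  rw [wall, div_mul_cancel₀ _ cos_pos.ne']
  have : (2 * ((3 : ℕ) : ℝ) + 1) * (Real.pi / 7) = Real.pi := by push_cast; ring
  rw [this, Real.cos_pi]

theorem wall_succ_lt {m : ℕ} (hm : m < 3) : wall (m + 1) < wall m := by
  have h2 : (m : ℝ) ≤ 2 := by exact_mod_cast Nat.lt_succ_iff.1 hm
  have := Real.pi_pos
  refine div_lt_div_of_pos_right ?_ cos_pos
  apply Real.cos_lt_cos_of_nonneg_of_le_pi
  · positivity
  · push_cast; nlinarith
  · push_cast; nlinarith

theorem wall_lt {m n : ℕ} (hn : n ≤ 3) (h : m < n) : wall n < wall m := by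
  induction n, h using Nat.le_induction with
  | base => exact wall_succ_lt hn
  | succ n h ih => exact (wall_succ_lt hn).trans (ih (by omega))

theorem wall_le {m n : ℕ} (hn : n ≤ 3) (h : m ≤ n) : wall n ≤ wall m := by
  rcases h.eq_or_lt with rfl | h
  · exact le_rfl
  · exact (wall_lt hn h).le

theorem wall_add (j : ℕ) : wall (j + 1) + wall j = 2 * co (j + 1) := by
  rw [wall, wall, co, ← add_div, Real.cos_add_cos]
  have h1 : ((2 * ((j + 1 : ℕ) : ℝ) + 1) * (Real.pi / 7) + (2 * j + 1) * (Real.pi / 7)) / 2 =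
      ((j + 1 : ℕ) : ℝ) * (2 * (Real.pi / 7)) := by push_cast; ring
  have h2 : ((2 * ((j + 1 : ℕ) : ℝ) + 1) * (Real.pi / 7) - (2 * j + 1) * (Real.pi / 7)) / 2 =
      Real.pi / 7 := by push_cast; ring
  rw [h1, h2, mul_div_assoc, div_self cos_pos.ne', mul_one]

theorem neg_cos_le_co {m : ℕ} (hm : m ≤ 3) : -Real.cos (Real.pi / 7) ≤ co m := by
  rw [← Real.cos_pi_sub, co]
  have h2 : (m : ℝ) ≤ 3 := by exact_mod_cast hm
  have := Real.pi_pos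
  apply Real.cos_le_cos_of_nonneg_of_le_pi
  · positivity
  · linarith
  · nlinarith

theorem co_lt_one {m : ℕ} (h0 : 0 < m) (hm : m ≤ 3) : co m < 1 := by
  nlinarith [co_sq_add_si_sq m, si_pos h0 hm]

theorem co_mul_lt_one {m : ℕ} (h0 : 0 < m) (hm : m ≤ 3) {x : ℝ} (h1 : wall 3 < x) (h2 : x ≤ 1) :
    co m * x < 1 := by
  have h3 := neg_cos_le_co hm
  have h4 := co_lt_one h0 hm
  have h5 := wall_three_mul_cos
  have h6 := cos_pos
  rcases le_or_gt x 0 with hx | hx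
  · nlinarith
  · nlinarith

theorem co_mul_le_one {m : ℕ} (h0 : 0 < m) (hm : m ≤ 3) {x : ℝ} (h1 : wall 3 ≤ x) (h2 : x ≤ 1) :
    co m * x ≤ 1 := by
  have h3 := neg_cos_le_co hm
  have h4 := co_lt_one h0 hm
  have h5 := wall_three_mul_cos
  have h6 := cos_pos
  rcases le_or_gt x 0 with hx | hx
  · nlinarith
  · nlinarith

theorem wall_three_le_re {z : ℂ} (hz : z ∈ heptagon) : wall 3 ≤ z.re := by
  have h := mem_heptagon_iff.1 hz 3 le_rfl
  have h1 : co 3 = -Real.cos (Real.pi / 7) := by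
    rw [← Real.cos_pi_sub, co]; congr 1; push_cast; ring
  have h2 := si_pos (m := 3) (by norm_num) le_rfl
  have h3 := wall_three_mul_cos
  have h4 := cos_pos
  rw [level, h1] at h
  by_contra! hlt
  nlinarith [mul_nonneg h2.le (abs_nonneg z.im), mul_lt_mul_of_pos_right hlt h4]

theorem re_le_one {z : ℂ} (hz : z ∈ heptagon) : z.re ≤ 1 := by
  have h := mem_heptagon_iff.1 hz 0 (by norm_num)
  simpa [level, co_zero, si_zero] using h

/-- The closed vertical strip between two consecutive walls. Its intersection with the heptagon is
one of the three pieces (two trapezoids and a triangle) cut out by the vertical diagonals. -/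
def strip (j : ℕ) : Set ℂ := {z | wall (j + 1) ≤ z.re ∧ z.re ≤ wall j}

/-- The open vertical strip between two consecutive walls. -/
def openStrip (j : ℕ) : Set ℂ := {z | wall (j + 1) < z.re ∧ z.re < wall j}

theorem openStrip_subset (j : ℕ) : openStrip j ⊆ strip j := fun _ h => ⟨h.1.le, h.2.le⟩

theorem isOpen_openStrip (j : ℕ) : IsOpen (openStrip j) :=
  (isOpen_lt continuous_const Complex.continuous_re).inter
    (isOpen_lt Complex.continuous_re continuous_const)

theorem isClosed_strip (j : ℕ) : IsClosed (strip j) :=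
  (isClosed_le continuous_const Complex.continuous_re).inter
    (isClosed_le Complex.continuous_re continuous_const)

theorem mem_strip_of_re_eq {j : ℕ} {z w : ℂ} (hz : z ∈ strip j) (h : w.re = z.re) :
    w ∈ strip j := by
  rw [strip, Set.mem_ofPred_eq, h]; exact hz

theorem mem_openStrip_of_re_eq {j : ℕ} {z w : ℂ} (hz : z ∈ openStrip j) (h : w.re = z.re) :
    w ∈ openStrip j := by
  rw [openStrip, Set.mem_ofPred_eq, h]; exact hz

theorem level_lt_one {j m : ℕ} (hj : j < 3) (hm : m ≤ 3) (hne : m ≠ j + 1) {z : ℂ}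
    (hz : z ∈ openStrip j) (h : level (j + 1) z ≤ 1) : level m z < 1 := by
  rcases lt_or_gt_of_ne hne with hlt | hlt
  · have hmj : m ≤ j := Nat.lt_succ_iff.1 hlt
    clear hne hlt hm
    induction hmj using Nat.decreasingInduction with
    | self => exact level_lt_of_succ hj hz.2 h
    | of_succ k hk ih =>
      exact level_lt_of_succ (by omega) (hz.2.trans_le (wall_le (by omega) hk.le)) ih.le
  · clear hne
    induction m, hlt using Nat.le_induction with
    | base => exact level_succ_lt (by omega) hm hz.1 h
    | succ k hk ih =>
      refine level_succ_lt (by omega) hm (lt_of_le_of_lt (wall_le (by omega) ?_) hz.1)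
        (ih (by omega)).le
      omega

/-- Above and below a strip, the heptagon is bounded by two conjugate sides only. -/
theorem mem_heptagon_of_level {j : ℕ} (hj : j < 3) {z : ℂ} (hz : z ∈ strip j)
    (h : level (j + 1) z ≤ 1) : z ∈ heptagon := by
  rw [mem_heptagon_iff]
  intro m hm
  rcases lt_trichotomy m (j + 1) with hlt | rfl | hlt
  · have hmj : m ≤ j := Nat.lt_succ_iff.1 hlt
    clear hlt hm
    induction hmj using Nat.decreasingInduction with
    | self => exact level_le_of_succ hj hz.2 h
    | of_succ k hk ih =>
      exact level_le_of_succ (by omega) (hz.2.trans (wall_le (by omega) hk.le)) ih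
  · exact h
  · induction m, hlt using Nat.le_induction with
    | base => exact level_succ_le (by omega) hm hz.1 h
    | succ k hk ih =>
      refine level_succ_le (by omega) hm (le_trans (wall_le (by omega) ?_) hz.1) (ih (by omega))
      omega

theorem dot_lt_one {j : ℕ} (hj : j < 3) {z : ℂ} (hz : z ∈ openStrip j)
    (h : level (j + 1) z ≤ 1) {v : ℂ} (hv : v ^ 7 = 1) (h1 : v ≠ normal (j + 1))
    (h2 : v ≠ (starRingEnd ℂ) (normal (j + 1))) : dot v z < 1 := by
  obtain ⟨m, hm, hvm⟩ := eq_normal hv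
  have hne : m ≠ j + 1 := by rintro rfl; exact hvm.elim h1 h2
  have h3 := (level_lt_iff hm).1 (level_lt_one hj hm hne hz h)
  rcases hvm with rfl | rfl
  · exact h3.1
  · exact h3.2

theorem exists_strip {x : ℝ} (h1 : wall 3 ≤ x) (h2 : x ≤ 1) :
    ∃ j < 3, wall (j + 1) ≤ x ∧ x ≤ wall j := by
  by_cases h : wall 1 ≤ x
  · exact ⟨0, by norm_num, h, wall_zero ▸ h2⟩
  by_cases h' : wall 2 ≤ x
  · exact ⟨1, by norm_num, h', (not_le.1 h).le⟩
  · exact ⟨2, by norm_num, h1, (not_le.1 h').le⟩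

theorem strip_re_mem {j : ℕ} (hj : j < 3) {z : ℂ} (hz : z ∈ strip j) :
    wall 3 ≤ z.re ∧ z.re ≤ 1 :=
  ⟨(wall_le le_rfl hj).trans hz.1, wall_zero ▸ hz.2.trans (wall_le hj.le (Nat.zero_le j))⟩

/-- The two sides bounding the heptagon above and below a strip meet outside the open strip. -/
theorem co_mul_re_lt {j : ℕ} (hj : j < 3) {z : ℂ} (hz : z ∈ openStrip j) :
    co (j + 1) * z.re < 1 :=
  co_mul_lt_one (Nat.succ_pos j) hj ((wall_le le_rfl hj).trans_lt hz.1)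
    (strip_re_mem hj (openStrip_subset j hz)).2

theorem co_mul_re_le {j : ℕ} (hj : j < 3) {z : ℂ} (hz : z ∈ strip j) :
    co (j + 1) * z.re ≤ 1 :=
  co_mul_le_one (Nat.succ_pos j) hj (strip_re_mem hj hz).1 (strip_re_mem hj hz).2

theorem reflect_mem_strip {j : ℕ} {z : ℂ} (hz : z ∈ strip j) :
    2 * normal (j + 1) - z ∈ strip j := by
  have h := wall_add j
  have e : (2 * normal (j + 1) - z).re = 2 * co (j + 1) - z.re := by simp [normal]
  rw [strip, Set.mem_ofPred_eq, e]
  exact ⟨by linarith [hz.2], by linarith [hz.1]⟩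

theorem reflect_mem_openStrip {j : ℕ} {z : ℂ} (hz : z ∈ openStrip j) :
    2 * normal (j + 1) - z ∈ openStrip j := by
  have h := wall_add j
  have e : (2 * normal (j + 1) - z).re = 2 * co (j + 1) - z.re := by simp [normal]
  rw [openStrip, Set.mem_ofPred_eq, e]
  exact ⟨by linarith [hz.2], by linarith [hz.1]⟩

/-- Vertices of the heptagon lie on the walls. -/
theorem not_isVertex_of_mem_openStrip {j : ℕ} (hj : j < 3) {z : heptagon}
    (hz : (z : ℂ) ∈ openStrip j) : ¬ IsVertex (Sum.inl z) := by
  rintro ⟨u, v, hu, hv, huv, h1, h2⟩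
  have hl := mem_heptagon_iff.1 z.2 (j + 1) hj
  have key : ∀ w : ℂ, w ^ 7 = 1 → dot w z = 1 →
      w = normal (j + 1) ∨ w = (starRingEnd ℂ) (normal (j + 1)) := by
    intro w hw hwz
    by_contra! hne
    exact (dot_lt_one hj hz hl hw hne.1 hne.2).ne hwz
  have hlt := co_mul_re_lt hj hz
  have hd := dot_normal (j + 1) z
  have hd' := dot_conj_normal (j + 1) z
  rcases key u hu h1 with rfl | rfl <;> rcases key v hv h2 with rfl | rfl
  · exact huv rfl
  · linarith
  · linarith
  · exact huv rfl

theorem isVertex_neg {z : ℂ} (hz : z ∈ oppHeptagon) (h : IsVertex (Sum.inr ⟨z, hz⟩)) :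
    IsVertex (Sum.inl ⟨-z, neg_mem_heptagon_iff.2 hz⟩) := by
  obtain ⟨u, v, hu, hv, huv, h1, h2⟩ := h
  exact ⟨u, v, hu, hv, huv, by rw [dot_neg, h1, neg_neg], by rw [dot_neg, h2, neg_neg]⟩

/-- The sides with normal `normal (j + 1)` or its conjugate lie in the strip of index `j`. -/
theorem mem_strip_of_side {j : ℕ} (hj : j < 3) {z : ℂ} (hz : z ∈ heptagon)
    (h : 1 ≤ level (j + 1) z) : z ∈ strip j := by
  have hl := mem_heptagon_iff.1 hz
  have h4 := si_pos one_pos (by norm_num)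
  have h1 : level (j + 1) z = 1 := le_antisymm (hl _ hj) h
  constructor
  · rcases Nat.lt_succ_iff.1 hj |>.eq_or_lt with rfl | hj2
    · exact wall_three_le_re hz
    · have h2 := level_step (j + 1) z
      have h3 := mul_nonneg (si_nonneg (m := j + 1) hj) (sub_nonneg.2 (hl (j + 2) (by omega)))
      rw [h1] at h2
      have : 0 ≤ si 1 * (z.re - wall (j + 1)) := by linarith
      linarith [(mul_nonneg_iff_of_pos_left h4).1 this]
  · have h2 := level_step j z
    have h3 := mul_nonneg (si_nonneg (m := j + 1) hj) (sub_nonneg.2 (hl j hj.le))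
    rw [h1] at h2
    have : 0 ≤ si 1 * (wall j - z.re) := by linarith
    linarith [(mul_nonneg_iff_of_pos_left h4).1 this]

theorem mem_dom_left {u z : ℂ} (hu : u ^ 7 = 1) (hz : z ∈ heptagon)
    (h : ∀ v : ℂ, v ^ 7 = 1 → v ≠ u → dot v z < 1) : z ∈ dom u := by
  intro v hv hvu
  refine ⟨fun _ => h v hv hvu, fun h1 => ?_⟩
  have h2 : dot u z = 1 := le_antisymm (hz u hu) h1
  rw [dot_mirror hu h2]
  linarith [h _ (mirror_pow hu hv) (mirror_ne hu hvu)]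

theorem mem_dom_right {u z : ℂ} (hu : u ^ 7 = 1) (hz : z - 2 * u ∈ oppHeptagon)
    (h : ∀ v : ℂ, v ^ 7 = 1 → v ≠ u → -1 < dot v (z - 2 * u)) : z ∈ dom u := by
  intro v hv hvu
  refine ⟨fun h1 => ?_, fun _ => h v hv hvu⟩
  have h0 := hz u hu
  rw [dot_sub hu] at h0
  have h2 : dot u z = 1 := by linarith
  have h3 := h _ (mirror_pow hu hv) (mirror_ne hu hvu)
  rw [dot_mirror hu h2, mirror_mirror hu] at h3
  linarith

/-! ### The three vertical cylinders -/

/-- The circumference of the vertical cylinder of index `j`. -/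
noncomputable def circ (j : ℕ) : ℝ := 4 * si (j + 1)

/-- How far, in the direction normal to it, `z` lies above the lower side of the heptagon in the
strip of index `j`. -/
noncomputable def height (j : ℕ) (z : ℂ) : ℝ := 1 - dot ((starRingEnd ℂ) (normal (j + 1))) z

/-- The increase of `height j` along one turn around the cylinder of index `j`. -/
noncomputable def period (j : ℕ) : ℝ := 4 * si (j + 1) ^ 2

theorem period_pos {j : ℕ} (hj : j < 3) : 0 < period j := by
  have := si_pos (Nat.succ_pos j) hj
  unfold period; positivity

theorem height_eq (j : ℕ) (z : ℂ) : height j z = 1 - co (j + 1) * z.re + si (j + 1) * z.im := by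
  rw [height, dot_conj_normal]; ring

theorem continuous_height (j : ℕ) : Continuous (height j) :=
  continuous_const.sub (continuous_dot _)

theorem height_add_mul_circ (j : ℕ) (z : ℂ) (s : ℝ) :
    height j (z + (s * circ j : ℝ) * Complex.I) = height j z + s * period j := by
  simp only [height_eq, circ, period, Complex.add_re, Complex.add_im, Complex.re_ofReal_mul,
    Complex.im_ofReal_mul, Complex.I_re, Complex.I_im]
  ring

theorem height_reflect (j : ℕ) (z : ℂ) :
    height j (2 * normal (j + 1) - z) = period j - height j z := by
  have := co_sq_add_si_sq (j + 1)
  simp [height_eq, period, normal]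
  linear_combination -2 * this

theorem dot_reflect (j : ℕ) (z : ℂ) :
    dot (normal (j + 1)) (2 * normal (j + 1) - z) = 2 - dot (normal (j + 1)) z := by
  have h := dot_sub (z := z) (normal_pow (j + 1))
  rw [← neg_sub, dot_neg, h]; ring

theorem reflect_mem_heptagon_iff {u z : ℂ} : 2 * u - z ∈ heptagon ↔ z - 2 * u ∈ oppHeptagon := by
  rw [← neg_mem_heptagon_iff, neg_sub]

theorem mem_heptagon_of_height {j : ℕ} (hj : j < 3) {z : ℂ} (hz : z ∈ strip j)
    (h : 0 ≤ height j z) (h1 : dot (normal (j + 1)) z ≤ 1) : z ∈ heptagon :=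
  mem_heptagon_of_level hj hz ((level_le_iff hj).2 ⟨h1, by rw [height] at h; linarith⟩)

theorem mem_oppHeptagon_of_height {j : ℕ} (hj : j < 3) {z : ℂ} (hz : z ∈ strip j)
    (h : height j z ≤ period j) (h1 : 1 ≤ dot (normal (j + 1)) z) :
    z - 2 * normal (j + 1) ∈ oppHeptagon := by
  rw [← reflect_mem_heptagon_iff]
  refine mem_heptagon_of_height hj (reflect_mem_strip hz) ?_ ?_
  · rw [height_reflect]; linarith
  · rw [dot_reflect]; linarith

theorem height_nonneg {j : ℕ} {z : ℂ} (hz : z ∈ heptagon) : 0 ≤ height j z :=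
  sub_nonneg.2 (hz _ (conj_pow (normal_pow _)))

theorem height_le_period {j : ℕ} (hj : j < 3) {z : ℂ} (hs : z ∈ strip j) (hz : z ∈ heptagon) :
    height j z ≤ period j := by
  have h1 := co_mul_re_le hj (reflect_mem_strip hs)
  have h2 := hz _ (normal_pow (j + 1))
  have h3 := co_sq_add_si_sq (j + 1)
  rw [dot_normal] at h2
  have e : (2 * normal (j + 1) - z).re = 2 * co (j + 1) - z.re := by simp [normal]
  rw [e] at h1
  rw [height_eq, period]
  nlinarith

theorem dot_le_one_of_height_eq_zero {j : ℕ} (hj : j < 3) {z : ℂ} (hs : z ∈ strip j)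
    (h : height j z = 0) : dot (normal (j + 1)) z ≤ 1 := by
  have h1 := co_mul_re_le hj hs
  rw [height_eq] at h
  rw [dot_normal]; linarith

theorem one_le_dot_of_height_eq_period {j : ℕ} (hj : j < 3) {z : ℂ} (hs : z ∈ strip j)
    (h : height j z = period j) : 1 ≤ dot (normal (j + 1)) z := by
  have h1 := dot_le_one_of_height_eq_zero hj (reflect_mem_strip hs)
    (by rw [height_reflect, h, sub_self])
  rw [dot_reflect] at h1; linarith

/-- The part of the strip of index `j` that lies between the lower side of the heptagon and the
upper side of the opposite heptagon put on top of it: a fundamental domain for the cylinder. -/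
def band (j : ℕ) : Set ℂ := {z | z ∈ strip j ∧ 0 ≤ height j z ∧ height j z ≤ period j}

theorem param_of_mem_heptagon {u z : ℂ} (hu : u ^ 7 = 1) (hz : z ∈ heptagon) :
    param u z = proj (Sum.inl ⟨z, hz⟩) := param_left hz (hz u hu)

theorem param_of_mem_oppHeptagon {u z : ℂ} (hu : u ^ 7 = 1) (hz : z - 2 * u ∈ oppHeptagon) :
    param u z = proj (Sum.inr ⟨z - 2 * u, hz⟩) := by
  have h := hz u hu
  rw [dot_sub hu] at h
  exact param_right hu hz (by linarith)

theorem conj_normal_eq (j : ℕ) :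
    2 * (starRingEnd ℂ) (normal (j + 1)) = 2 * normal (j + 1) - circ j * Complex.I := by
  apply Complex.ext
  · simp [normal]
  · simp [normal, circ]; ring

/-- Over the closed upper boundary of the band, the parametrization agrees with the one over the
lower boundary, because of the gluing along the sides with conjugate normals. -/
theorem param_sub_circ {j : ℕ} (hj : j < 3) {z : ℂ} (hs : z ∈ strip j)
    (h : height j z = period j) :
    param (normal (j + 1)) (z - circ j * Complex.I) = param (normal (j + 1)) z := by
  have hu := normal_pow (j + 1)
  have hc := conj_pow hu
  have h0 : height j (z - circ j * Complex.I) = 0 := by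
    have := height_add_mul_circ j z (-1)
    have e : z + ((-1 * circ j : ℝ) : ℂ) * Complex.I = z - circ j * Complex.I := by
      push_cast; ring
    rw [e] at this
    linarith
  have hs' : z - circ j * Complex.I ∈ strip j := mem_strip_of_re_eq hs (by simp)
  have hH := mem_heptagon_of_height hj hs' h0.ge (dot_le_one_of_height_eq_zero hj hs' h0)
  have hO := mem_oppHeptagon_of_height hj hs h.le (one_le_dot_of_height_eq_period hj hs h)
  rw [param_of_mem_heptagon hu hH, param_of_mem_oppHeptagon hu hO]
  refine Quot.sound (Glue.mk _ hc _ _ ?_ ?_)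
  · rw [height] at h0; simp only; linarith
  · simp only; rw [conj_normal_eq]; ring

theorem isClosed_heptagon : IsClosed heptagon := by
  have : heptagon = ⋂ u : ℂ, ⋂ _ : u ^ 7 = 1, {z | dot u z ≤ 1} := by
    ext z; simp [heptagon]
  rw [this]
  exact isClosed_iInter fun u => isClosed_iInter fun _ =>
    isClosed_le (continuous_dot u) continuous_const

theorem isClosed_oppHeptagon : IsClosed oppHeptagon := by
  have : oppHeptagon = ⋂ u : ℂ, ⋂ _ : u ^ 7 = 1, {z | -1 ≤ dot u z} := by
    ext z; simp [oppHeptagon]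
  rw [this]
  exact isClosed_iInter fun u => isClosed_iInter fun _ =>
    isClosed_le continuous_const (continuous_dot u)

theorem continuousOn_param_union {u : ℂ} (hu : u ^ 7 = 1) :
    ContinuousOn (param u) (heptagon ∪ {z | z - 2 * u ∈ oppHeptagon}) := by
  have hL : ContinuousOn (param u) heptagon := by
    rw [continuousOn_iff_continuous_domRestrict]
    have h : heptagon.domRestrict (param u) = fun z => proj (Sum.inl z) := by
      funext z; exact param_of_mem_heptagon hu z.2
    rw [h]
    exact continuous_proj.comp continuous_inl
  have hR : ContinuousOn (param u) {z | z - 2 * u ∈ oppHeptagon} := by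
    rw [continuousOn_iff_continuous_domRestrict]
    have h : {z | z - 2 * u ∈ oppHeptagon}.domRestrict (param u) =
        fun z => proj (Sum.inr ⟨z.1 - 2 * u, z.2⟩) := by
      funext z; exact param_of_mem_oppHeptagon hu z.2
    rw [h]
    exact continuous_proj.comp (continuous_inr.comp
      ((continuous_subtype_val.sub continuous_const).subtype_mk _))
  exact hL.union_of_isClosed hR isClosed_heptagon
    (isClosed_oppHeptagon.preimage (continuous_id.sub continuous_const))

theorem continuousOn_param_band {j : ℕ} (hj : j < 3) :
    ContinuousOn (param (normal (j + 1))) (band j) := by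
  refine (continuousOn_param_union (normal_pow (j + 1))).mono ?_
  rintro z ⟨hs, h0, h1⟩
  rcases le_total (dot (normal (j + 1)) z) 1 with h | h
  · exact Or.inl (mem_heptagon_of_height hj hs h0 h)
  · exact Or.inr (mem_oppHeptagon_of_height hj hs h1 h)

/-- The vertical cylinder of index `j` as a quotient of the vertical strip of index `j`: the
heptagon and the translate `oppHeptagon + 2 * normal (j + 1)` on top of it are sent to the surface
in the obvious way, and the map is extended with period `circ j * I`. Outside of the strip its
values are irrelevant. -/
noncomputable def cyl (j : ℕ) (z : ℂ) : Surface :=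
  param (normal (j + 1)) (z - (⌊height j z / period j⌋ * circ j : ℝ) * Complex.I)

theorem cyl_add_circ {j : ℕ} (hj : j < 3) (z : ℂ) (n : ℤ) :
    cyl j (z + (n * circ j : ℝ) * Complex.I) = cyl j z := by
  rw [cyl, cyl, height_add_mul_circ, add_div, mul_div_assoc, div_self (period_pos hj).ne', mul_one,
    Int.floor_add_intCast]
  congr 1
  push_cast; ring

theorem cyl_eq_param {j : ℕ} (hj : j < 3) {z : ℂ} (hz : z ∈ strip j) (n : ℤ)
    (h0 : n * period j ≤ height j z) (h1 : height j z ≤ (n + 1) * period j) :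
    cyl j z = param (normal (j + 1)) (z - (n * circ j : ℝ) * Complex.I) := by
  have hp := period_pos hj
  rcases h1.lt_or_eq with h1 | h1
  · have : ⌊height j z / period j⌋ = n := by
      rw [Int.floor_eq_iff, le_div_iff₀ hp, div_lt_iff₀ hp]; exact ⟨h0, h1⟩
    rw [cyl, this]
  · have : ⌊height j z / period j⌋ = n + 1 := by
      rw [h1, mul_div_assoc, div_self hp.ne', mul_one]; exact_mod_cast Int.floor_intCast (n + 1)
    rw [cyl, this, ← param_sub_circ hj (z := z - (n * circ j : ℝ) * Complex.I)]
    · congr 1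
      push_cast; ring
    · exact mem_strip_of_re_eq hz (by simp)
    · have := height_add_mul_circ j z (-n)
      rw [h1] at this
      rw [sub_eq_add_neg, ← neg_mul, ← Complex.ofReal_neg, ← neg_mul, this]
      ring

theorem cyl_eq_param_of_mem_band {j : ℕ} (hj : j < 3) {z : ℂ} (hz : z ∈ band j) :
    cyl j z = param (normal (j + 1)) z := by
  have := cyl_eq_param hj hz.1 0 (by simpa using hz.2.1) (by simpa using hz.2.2)
  simpa using this

theorem cyl_inl {j : ℕ} (hj : j < 3) {z : ℂ} (hs : z ∈ strip j) (hz : z ∈ heptagon) :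
    cyl j z = proj (Sum.inl ⟨z, hz⟩) := by
  rw [cyl_eq_param_of_mem_band hj ⟨hs, height_nonneg hz, height_le_period hj hs hz⟩,
    param_of_mem_heptagon (normal_pow _) hz]

theorem cyl_inr {j : ℕ} (hj : j < 3) {z : ℂ} (hs : z + 2 * normal (j + 1) ∈ strip j)
    (hz : z ∈ oppHeptagon) :
    cyl j (z + 2 * normal (j + 1)) = proj (Sum.inr ⟨z, hz⟩) := by
  have hs' := reflect_mem_strip hs
  have hh : 2 * normal (j + 1) - (z + 2 * normal (j + 1)) ∈ heptagon := by
    rw [reflect_mem_heptagon_iff, add_sub_cancel_right]; exact hz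
  have h0 := height_nonneg (j := j) hh
  have h1 := height_le_period hj hs' hh
  rw [height_reflect] at h0 h1
  rw [cyl_eq_param_of_mem_band hj ⟨hs, by linarith, by linarith⟩,
    param_of_mem_oppHeptagon (normal_pow _) (by rw [add_sub_cancel_right]; exact hz)]
  simp only [add_sub_cancel_right]

/-- Every point of the closed strip is a translate, by a multiple of the circumference, of a point
of the band. -/
theorem exists_band {j : ℕ} (hj : j < 3) {z : ℂ} (hz : z ∈ strip j) :
    ∃ n : ℤ, ∃ w ∈ band j, height j w < period j ∧ z = w + (n * circ j : ℝ) * Complex.I := by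
  have hp := period_pos hj
  refine ⟨⌊height j z / period j⌋, z - (⌊height j z / period j⌋ * circ j : ℝ) * Complex.I, ?_⟩
  have h := height_add_mul_circ j (z - (⌊height j z / period j⌋ * circ j : ℝ) * Complex.I)
    ⌊height j z / period j⌋
  rw [sub_add_cancel] at h
  have h1 := (le_div_iff₀ hp).1 (Int.floor_le (height j z / period j))
  have h2 := (div_lt_iff₀ hp).1 (Int.lt_floor_add_one (height j z / period j))
  refine ⟨⟨mem_strip_of_re_eq hz (by simp), ?_, ?_⟩, ?_, (sub_add_cancel _ _).symm⟩ <;> linarith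

theorem band_cases {j : ℕ} (hj : j < 3) {w : ℂ} (hw : w ∈ band j) :
    w ∈ heptagon ∨ w - 2 * normal (j + 1) ∈ oppHeptagon := by
  rcases le_total (dot (normal (j + 1)) w) 1 with h | h
  · exact Or.inl (mem_heptagon_of_height hj hw.1 hw.2.1 h)
  · exact Or.inr (mem_oppHeptagon_of_height hj hw.1 hw.2.2 h)

theorem continuousOn_cyl {j : ℕ} (hj : j < 3) : ContinuousOn (cyl j) (strip j) := by
  have hp := period_pos hj
  set S : ℤ → Set ℂ := fun n => {z | z ∈ strip j ∧ n * period j ≤ height j z ∧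
    height j z ≤ (n + 1) * period j} with hS
  have hcl : ∀ n, IsClosed (S n) := fun n => (isClosed_strip j).inter
    ((isClosed_le continuous_const (continuous_height j)).inter
      (isClosed_le (continuous_height j) continuous_const))
  have hU : strip j ⊆ ⋃ n, S n := by
    intro z hz
    refine Set.mem_iUnion.2 ⟨⌊height j z / period j⌋, hz, ?_, ?_⟩
    · exact (le_div_iff₀ hp).1 (Int.floor_le _)
    · exact ((div_lt_iff₀ hp).1 (Int.lt_floor_add_one _)).le
  have hfin : LocallyFinite S := by
    intro z
    refine ⟨{w | |height j w - height j z| < period j}, ?_, ?_⟩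
    · apply (isOpen_lt ((continuous_height j).sub continuous_const).abs continuous_const).mem_nhds
      simpa using hp
    · refine (Set.finite_Icc ⌊height j z / period j - 2⌋ ⌈height j z / period j + 1⌉).subset ?_
      rintro n ⟨w, ⟨_, h1, h2⟩, h3⟩
      obtain ⟨h3, h4⟩ := abs_lt.1 (show |height j w - height j z| < period j from h3)
      have e : height j z / period j * period j = height j z := div_mul_cancel₀ _ hp.ne'
      constructor
      · have : height j z / period j - 2 ≤ n := by
          by_contra! hlt
          nlinarith
        exact_mod_cast (Int.floor_le _).trans this
      · have : (n : ℝ) ≤ height j z / period j + 1 := by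
          by_contra! hlt
          nlinarith
        exact_mod_cast this.trans (Int.le_ceil _)
  refine (hfin.continuousOn_iUnion hcl fun n => ?_).mono hU
  have h := (continuousOn_param_band hj).comp (s := S n)
    (f := fun z => z - (n * circ j : ℝ) * Complex.I)
    (continuous_id.sub continuous_const).continuousOn ?_
  · exact h.congr fun z hz => cyl_eq_param hj hz.1 n hz.2.1 hz.2.2
  · rintro z ⟨hs, h1, h2⟩
    have := height_add_mul_circ j z (-n)
    rw [neg_mul, Complex.ofReal_neg, neg_mul, ← sub_eq_add_neg] at this
    refine ⟨mem_strip_of_re_eq hs (by simp), ?_, ?_⟩ <;> rw [this] <;> linarith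

/-! ### The multi-twist along the vertical cylinders -/

/-- The common ratio `2 cot (π/7)` of circumference to width of the three vertical cylinders. -/
noncomputable def slope : ℝ := 2 * Real.cos (Real.pi / 7) / Real.sin (Real.pi / 7)

theorem slope_mul_width (j : ℕ) : slope * (wall j - wall (j + 1)) = circ j := by
  rw [slope, wall, wall, circ, si, ← sub_div, Real.cos_sub_cos]
  have h1 : ((2 * (j : ℝ) + 1) * (Real.pi / 7) + (2 * ((j + 1 : ℕ) : ℝ) + 1) * (Real.pi / 7)) / 2 =
      ((j + 1 : ℕ) : ℝ) * (2 * (Real.pi / 7)) := by push_cast; ring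
  have h2 : ((2 * (j : ℝ) + 1) * (Real.pi / 7) - (2 * ((j + 1 : ℕ) : ℝ) + 1) * (Real.pi / 7)) / 2 =
      -(Real.pi / 7) := by push_cast; ring
  rw [h1, h2, Real.sin_neg]
  field_simp [cos_pos.ne', sin_pos.ne']
  ring

/-- The vertical shear of slope `s` that fixes the line of abscissa `x₀`. -/
noncomputable def shear (s x₀ : ℝ) (z : ℂ) : ℂ := z + (s * (z.re - x₀) : ℝ) * Complex.I

theorem shear_re (s x₀ : ℝ) (z : ℂ) : (shear s x₀ z).re = z.re := by simp [shear]

theorem continuous_shear (s x₀ : ℝ) : Continuous (shear s x₀) := by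
  unfold shear; fun_prop

theorem shear_shear (s t x₀ : ℝ) (z : ℂ) : shear s x₀ (shear t x₀ z) = shear (s + t) x₀ z := by
  rw [shear, shear_re, shear, shear]; push_cast; ring

theorem shear_zero (x₀ : ℝ) (z : ℂ) : shear 0 x₀ z = z := by simp [shear]

theorem shear_add_I (s x₀ y : ℝ) (z : ℂ) :
    shear s x₀ (z + y * Complex.I) = shear s x₀ z + y * Complex.I := by
  simp [shear]; ring

theorem shear_mem_strip {s x₀ : ℝ} {j : ℕ} {z : ℂ} (hz : z ∈ strip j) :
    shear s x₀ z ∈ strip j := mem_strip_of_re_eq hz (shear_re _ _ _)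

/-- Moving the fixed line from the left to the right end of a cylinder changes the `k`-fold twist
by `k` full turns, hence not at all. -/
theorem cyl_shear_left {j : ℕ} (hj : j < 3) (k : ℤ) (z : ℂ) :
    cyl j (shear (k * slope) (wall (j + 1)) z) = cyl j (shear (k * slope) (wall j) z) := by
  rw [← cyl_add_circ hj (shear (k * slope) (wall j) z) k, ← slope_mul_width, shear, shear]
  congr 1
  push_cast; ring

theorem cyl_shear_of_re_eq {j : ℕ} (hj : j < 3) (k : ℤ) {z : ℂ}
    (h : z.re = wall (j + 1) ∨ z.re = wall j) :
    cyl j (shear (k * slope) (wall (j + 1)) z) = cyl j z := by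
  rcases h with h | h
  · simp [shear, h]
  · rw [cyl_shear_left hj]; simp [shear, h]

open Classical in
/-- The index of a strip containing the abscissa `x`. -/
noncomputable def stripIndex (x : ℝ) : ℕ := if wall 1 ≤ x then 0 else if wall 2 ≤ x then 1 else 2

theorem stripIndex_lt (x : ℝ) : stripIndex x < 3 := by
  unfold stripIndex; split_ifs <;> norm_num

theorem stripIndex_mem {x : ℝ} (h1 : wall 3 ≤ x) (h2 : x ≤ 1) :
    wall (stripIndex x + 1) ≤ x ∧ x ≤ wall (stripIndex x) := by
  unfold stripIndex
  split_ifs with h h'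
  · exact ⟨h, wall_zero ▸ h2⟩
  · exact ⟨h', (not_le.1 h).le⟩
  · exact ⟨h1, (not_le.1 h').le⟩

/-- Two strips sharing an abscissa coincide, or are adjacent with the abscissa on the wall between
them. -/
theorem eq_or_adjacent {i j : ℕ} (hi : i < 3) (hj : j < 3) {x : ℝ}
    (h1 : wall (i + 1) ≤ x ∧ x ≤ wall i) (h2 : wall (j + 1) ≤ x ∧ x ≤ wall j) :
    i = j ∨ ((x = wall (i + 1) ∨ x = wall i) ∧ (x = wall (j + 1) ∨ x = wall j)) := by
  rcases lt_trichotomy i j with h | h | h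
  · right
    have h3 := wall_le (m := i + 1) (n := j) hj.le h
    have e1 : x = wall (i + 1) := by linarith [h1.1, h2.2]
    have e2 : x = wall j := by linarith [h1.1, h2.2]
    exact ⟨Or.inl e1, Or.inr e2⟩
  · exact Or.inl h
  · right
    have h3 := wall_le (m := j + 1) (n := i) hi.le h
    have e1 : x = wall i := by linarith [h1.2, h2.1]
    have e2 : x = wall (j + 1) := by linarith [h1.2, h2.1]
    exact ⟨Or.inr e1, Or.inl e2⟩

theorem add_normal_mem_strip {j : ℕ} {z : ℂ} :
    z + 2 * normal (j + 1) ∈ strip j ↔ wall (j + 1) ≤ -z.re ∧ -z.re ≤ wall j := by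
  have h := wall_add j
  have e : (z + 2 * normal (j + 1)).re = z.re + 2 * co (j + 1) := by simp [normal]
  rw [strip, Set.mem_ofPred_eq, e]
  constructor <;> rintro ⟨h1, h2⟩ <;> constructor <;> linarith

/-- The `k`-fold multi-twist, on the disjoint union of the two heptagons. -/
noncomputable def piecesTwist (k : ℤ) : Pieces → Surface
  | Sum.inl z => cyl (stripIndex (z : ℂ).re)
      (shear (k * slope) (wall (stripIndex (z : ℂ).re + 1)) z)
  | Sum.inr z => cyl (stripIndex (-(z : ℂ).re))
      (shear (k * slope) (wall (stripIndex (-(z : ℂ).re) + 1))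
        (z + 2 * normal (stripIndex (-(z : ℂ).re) + 1)))

theorem piecesTwist_inl (k : ℤ) {j : ℕ} (hj : j < 3) (z : heptagon) (hz : (z : ℂ) ∈ strip j) :
    piecesTwist k (Sum.inl z) = cyl j (shear (k * slope) (wall (j + 1)) z) := by
  have hi := stripIndex_lt (z : ℂ).re
  have hs := stripIndex_mem (wall_three_le_re z.2) (re_le_one z.2)
  rw [piecesTwist]
  rcases eq_or_adjacent hi hj hs hz with h | ⟨h1, h2⟩
  · rw [h]
  · rw [cyl_shear_of_re_eq hi k h1, cyl_shear_of_re_eq hj k h2, cyl_inl hi hs z.2, cyl_inl hj hz z.2]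

theorem oppHeptagon_re {z : ℂ} (hz : z ∈ oppHeptagon) : wall 3 ≤ -z.re ∧ -z.re ≤ 1 := by
  have h := neg_mem_heptagon_iff.2 hz
  exact ⟨wall_three_le_re h, re_le_one h⟩

theorem re_add_normal {j : ℕ} {z : ℂ} (h : -z.re = wall (j + 1) ∨ -z.re = wall j) :
    (z + 2 * normal (j + 1)).re = wall (j + 1) ∨ (z + 2 * normal (j + 1)).re = wall j := by
  have h0 := wall_add j
  have e : (z + 2 * normal (j + 1)).re = z.re + 2 * co (j + 1) := by simp [normal]
  rw [e]
  rcases h with h | h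
  · right; linarith
  · left; linarith

theorem piecesTwist_inr (k : ℤ) {j : ℕ} (hj : j < 3) (z : oppHeptagon)
    (hz : (z : ℂ) + 2 * normal (j + 1) ∈ strip j) :
    piecesTwist k (Sum.inr z) =
      cyl j (shear (k * slope) (wall (j + 1)) (z + 2 * normal (j + 1))) := by
  have hi := stripIndex_lt (-(z : ℂ).re)
  have hs := stripIndex_mem (oppHeptagon_re z.2).1 (oppHeptagon_re z.2).2
  rw [piecesTwist]
  rcases eq_or_adjacent hi hj hs (add_normal_mem_strip.1 hz) with h | ⟨h1, h2⟩
  · rw [h]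
  · rw [cyl_shear_of_re_eq hi k (re_add_normal h1), cyl_shear_of_re_eq hj k (re_add_normal h2),
      cyl_inr hi (add_normal_mem_strip.2 hs) z.2, cyl_inr hj hz z.2]

theorem normal_zero : normal 0 = 1 := by
  apply Complex.ext <;> simp [normal, co_zero, si_zero]

theorem piecesTwist_glue (k : ℤ) {x y : Pieces} (h : Glue x y) :
    piecesTwist k x = piecesTwist k y := by
  obtain ⟨u, hu, z, w, hz, hw⟩ := h
  obtain ⟨m, hm, hum⟩ := eq_normal hu
  rcases m with _ | j
  · -- the vertical side is the end of a cylinder, which is fixed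
    have hu1 : u = 1 := by
      rcases hum with rfl | rfl <;> simp [normal_zero]
    have hre : (z : ℂ).re = 1 := by rw [hu1] at hz; simpa [dot] using hz
    have hwre : (w : ℂ).re = -1 := by rw [hw, hu1]; simp [hre]; norm_num
    have h01 : (0 : ℕ) < 3 := by norm_num
    have hs : (z : ℂ) ∈ strip 0 := by
      refine ⟨?_, ?_⟩ <;> rw [hre, ← wall_zero]
      exact (wall_succ_lt h01).le
    have hs' : (w : ℂ) + 2 * normal (0 + 1) ∈ strip 0 := by
      rw [add_normal_mem_strip, hwre, neg_neg, wall_zero]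
      exact ⟨wall_zero ▸ (wall_succ_lt h01).le, le_rfl⟩
    rw [piecesTwist_inl k h01 z hs, piecesTwist_inr k h01 w hs',
      cyl_shear_of_re_eq h01 k (Or.inr (by rw [hre, wall_zero])),
      cyl_shear_of_re_eq h01 k (re_add_normal (Or.inr (by rw [hwre, wall_zero, neg_neg]))),
      cyl_inl h01 hs z.2, cyl_inr h01 hs' w.2]
    exact Quot.sound (Glue.mk u hu z w hz hw)
  · have hj : j < 3 := hm
    have hlev : 1 ≤ level (j + 1) z := by
      by_contra! hlt
      have := (level_lt_iff hm).1 hlt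
      rcases hum with rfl | rfl
      · exact this.1.ne hz
      · exact this.2.ne hz
    have hs : (z : ℂ) ∈ strip j := mem_strip_of_side hj z.2 hlev
    have hw' : (w : ℂ) + 2 * normal (j + 1) = z ∨
        (w : ℂ) + 2 * normal (j + 1) = z + (((1 : ℤ) : ℝ) * circ j : ℝ) * Complex.I := by
      rcases hum with rfl | rfl
      · left; rw [hw]; ring
      · right; rw [hw, conj_normal_eq]; push_cast; ring
    have hs' : (w : ℂ) + 2 * normal (j + 1) ∈ strip j := by
      rcases hw' with h | h <;> rw [h]
      · exact hs
      · exact mem_strip_of_re_eq hs (by simp)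
    rw [piecesTwist_inl k hj z hs, piecesTwist_inr k hj w hs']
    rcases hw' with h | h <;> rw [h]
    rw [shear_add_I, cyl_add_circ hj]

/-- The `k`-fold multi-twist: it turns every vertical cylinder `k` times and fixes the boundaries
of the cylinders. -/
noncomputable def twist (k : ℤ) : Surface → Surface :=
  Quot.lift (piecesTwist k) fun _ _ => piecesTwist_glue k

theorem twist_proj (k : ℤ) (x : Pieces) : twist k (proj x) = piecesTwist k x := rfl

/-- In the coordinates of a cylinder the twist is a shear. -/
theorem twist_cyl (k : ℤ) {j : ℕ} (hj : j < 3) {z : ℂ} (hz : z ∈ strip j) :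
    twist k (cyl j z) = cyl j (shear (k * slope) (wall (j + 1)) z) := by
  obtain ⟨n, w, hw, _, rfl⟩ := exists_band hj hz
  rw [shear_add_I, cyl_add_circ hj, cyl_add_circ hj]
  rcases band_cases hj hw with h | h
  · rw [cyl_inl hj hw.1 h, twist_proj, piecesTwist_inl k hj ⟨w, h⟩ hw.1]
  · have e : w - 2 * normal (j + 1) + 2 * normal (j + 1) = w := sub_add_cancel _ _
    have h1 := cyl_inr hj (by rw [e]; exact hw.1) h
    rw [e] at h1
    rw [h1, twist_proj, piecesTwist_inr k hj ⟨_, h⟩ (by simp only [e]; exact hw.1)]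
    simp only [e]

theorem exists_cyl (p : Surface) : ∃ j < 3, ∃ z ∈ strip j, cyl j z = p := by
  obtain ⟨x, rfl⟩ : ∃ x, proj x = p := Quot.exists_rep p
  rcases x with z | z
  · obtain ⟨j, hj, hs⟩ := exists_strip (wall_three_le_re z.2) (re_le_one z.2)
    exact ⟨j, hj, z, hs, cyl_inl hj hs z.2⟩
  · obtain ⟨j, hj, hs⟩ := exists_strip (oppHeptagon_re z.2).1 (oppHeptagon_re z.2).2
    have hs' := add_normal_mem_strip.2 hs
    exact ⟨j, hj, _, hs', cyl_inr hj hs' z.2⟩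

theorem twist_twist (k l : ℤ) (p : Surface) : twist k (twist l p) = twist (k + l) p := by
  obtain ⟨j, hj, z, hz, rfl⟩ := exists_cyl p
  rw [twist_cyl l hj hz, twist_cyl k hj (shear_mem_strip hz), shear_shear, twist_cyl _ hj hz]
  push_cast; rw [add_mul]

theorem twist_zero (p : Surface) : twist 0 p = p := by
  obtain ⟨j, hj, z, hz, rfl⟩ := exists_cyl p
  rw [twist_cyl 0 hj hz, Int.cast_zero, zero_mul, shear_zero]

theorem continuous_twist (k : ℤ) : Continuous (twist k) := by
  refine continuous_quot_lift _ (continuous_sum_dom.2 ⟨?_, ?_⟩)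
  · refine (locallyFinite_of_finite (fun j : Fin 3 => {z : heptagon | (z : ℂ) ∈ strip j})).continuous
      ?_ ?_ ?_
    · refine Set.eq_univ_of_forall fun z => Set.mem_iUnion.2 ?_
      obtain ⟨j, hj, hs⟩ := exists_strip (wall_three_le_re z.2) (re_le_one z.2)
      exact ⟨⟨j, hj⟩, hs⟩
    · exact fun j => (isClosed_strip j).preimage continuous_subtype_val
    · intro j
      refine ((continuousOn_cyl j.2).comp (f := fun z : heptagon =>
        shear (k * slope) (wall (j + 1)) (z : ℂ)) ?_ ?_).congr fun z hz =>
          piecesTwist_inl k j.2 z hz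
      · exact ((continuous_shear _ _).comp continuous_subtype_val).continuousOn
      · exact fun z hz => shear_mem_strip hz
  · refine (locallyFinite_of_finite (fun j : Fin 3 =>
      {z : oppHeptagon | (z : ℂ) + 2 * normal (j + 1) ∈ strip j})).continuous ?_ ?_ ?_
    · refine Set.eq_univ_of_forall fun z => Set.mem_iUnion.2 ?_
      obtain ⟨j, hj, hs⟩ := exists_strip (oppHeptagon_re z.2).1 (oppHeptagon_re z.2).2
      exact ⟨⟨j, hj⟩, add_normal_mem_strip.2 hs⟩
    · exact fun j => (isClosed_strip j).preimage (continuous_subtype_val.add continuous_const)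
    · intro j
      refine ((continuousOn_cyl j.2).comp (f := fun z : oppHeptagon =>
        shear (k * slope) (wall (j + 1)) ((z : ℂ) + 2 * normal (j + 1))) ?_ ?_).congr fun z hz =>
          piecesTwist_inr k j.2 z hz
      · exact ((continuous_shear _ _).comp
          (continuous_subtype_val.add continuous_const)).continuousOn
      · exact fun z hz => shear_mem_strip hz

/-- The multi-twist as a homeomorphism of the surface. -/
noncomputable def twistHomeo : Surface ≃ₜ Surface where
  toFun := twist 1
  invFun := twist (-1)
  left_inv p := by rw [twist_twist, neg_add_cancel, twist_zero]
  right_inv p := by rw [twist_twist, add_neg_cancel, twist_zero]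
  continuous_toFun := continuous_twist 1
  continuous_invFun := continuous_twist (-1)

theorem eq_wall_of_not_openStrip {j : ℕ} {x : ℝ} (h : wall (j + 1) ≤ x ∧ x ≤ wall j)
    (hn : ¬ (wall (j + 1) < x ∧ x < wall j)) : x = wall (j + 1) ∨ x = wall j := by
  rcases h.1.eq_or_lt with h1 | h1
  · exact Or.inl h1.symm
  · rcases h.2.eq_or_lt with h2 | h2
    · exact Or.inr h2
    · exact (hn ⟨h1, h2⟩).elim

theorem twist_of_mem_singularSet (k : ℤ) {p : Surface} (hp : p ∈ singularSet) : twist k p = p := by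
  obtain ⟨z | z, hx, rfl⟩ := hp
  · obtain ⟨j, hj, hs⟩ := exists_strip (wall_three_le_re z.2) (re_le_one z.2)
    have h := eq_wall_of_not_openStrip hs fun h => not_isVertex_of_mem_openStrip hj h hx
    rw [twist_proj, piecesTwist_inl k hj z hs, cyl_shear_of_re_eq hj k h, cyl_inl hj hs z.2]
  · obtain ⟨j, hj, hs⟩ := exists_strip (oppHeptagon_re z.2).1 (oppHeptagon_re z.2).2
    have h := eq_wall_of_not_openStrip hs fun h =>
      not_isVertex_of_mem_openStrip (z := ⟨-z, neg_mem_heptagon_iff.2 z.2⟩) hj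
        (by simpa [openStrip] using h) (isVertex_neg z.2 hx)
    have hs' := add_normal_mem_strip.2 hs
    rw [twist_proj, piecesTwist_inr k hj z hs', cyl_shear_of_re_eq hj k (re_add_normal h),
      cyl_inr hj hs' z.2]

theorem twist_mem_singularSet_iff (p : Surface) :
    twistHomeo p ∈ singularSet ↔ p ∈ singularSet := by
  constructor
  · intro h
    have h1 : twistHomeo (twistHomeo p) = twistHomeo p := twist_of_mem_singularSet 1 h
    rwa [twistHomeo.injective h1] at h
  · intro h
    have h1 : twistHomeo p = p := twist_of_mem_singularSet 1 h
    rwa [h1]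

end DoubleHeptagon

theorem planeAct_zero (A : SL(2, ℝ)) : planeAct A 0 = 0 := by
  apply Complex.ext <;> simp [planeAct]

theorem continuous_planeAct (A : SL(2, ℝ)) : Continuous (planeAct A) := by
  have h : planeAct A = fun z : ℂ => ((A 0 0 * z.re + A 0 1 * z.im : ℝ) : ℂ) +
      ((A 1 0 * z.re + A 1 1 * z.im : ℝ) : ℂ) * Complex.I := by
    funext z; apply Complex.ext <;> simp [planeAct]
  rw [h]; fun_prop

namespace TranslationStructure

/-! ### A local criterion for affine maps -/

variable {X : Type*} [TopologicalSpace X] (S : TranslationStructure X)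

/-- `f` is affine with linear part `A` near `p`, with respect to one chart around `p` and one chart
around `f p`. -/
def LocallyAffineAt (f : X → X) (A : SL(2, ℝ)) (p : X) : Prop :=
  ∃ φ ∈ S.atlas, ∃ ψ ∈ S.atlas, p ∈ φ.source ∧ f p ∈ ψ.source ∧
    ∀ᶠ q in 𝓝 p, ψ (f q) - ψ (f p) = planeAct A (φ q - φ p)

/-- `g` parametrizes the translation surface near `g z`: up to a translation it is inverse to a
chart. -/
def IsParamAt (g : ℂ → X) (z : ℂ) : Prop :=
  ContinuousAt g z ∧ ∃ φ ∈ S.atlas, g z ∈ φ.source ∧ ∀ᶠ w in 𝓝 z, φ (g w) - φ (g z) = w - z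

variable {S}

theorem isAffine_of_locallyAffineAt {f : X ≃ₜ X} {A : SL(2, ℝ)}
    (hf : ∀ p, f p ∈ S.singular ↔ p ∈ S.singular)
    (h : ∀ p, p ∉ S.singular → S.LocallyAffineAt f A p) : S.IsAffine f A := by
  refine ⟨hf, fun φ hφ ψ hψ p hp hq => ?_⟩
  obtain ⟨φ', hφ', ψ', hψ', hp', hq', he⟩ := h p ((S.covers p).2 ⟨φ, hφ, hp⟩)
  filter_upwards [he, S.transition φ hφ φ' hφ' p hp hp',
    f.continuous.continuousAt.eventually (S.transition ψ' hψ' ψ hψ (f p) hq' hq)] with q h1 h2 h3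
  rw [h3, h1, h2]

theorem LocallyAffineAt.comp {f g : X → X} {A B : SL(2, ℝ)} {p : X}
    (hg : S.LocallyAffineAt g B (f p)) (hf : S.LocallyAffineAt f A p) (hc : ContinuousAt f p) :
    S.LocallyAffineAt (g ∘ f) (B * A) p := by
  obtain ⟨φ, hφ, ψ, hψ, hp, hq, he⟩ := hf
  obtain ⟨φ', hφ', ψ', hψ', hp', hq', he'⟩ := hg
  refine ⟨φ, hφ, ψ', hψ', hp, hq', ?_⟩
  filter_upwards [he, hc.eventually he', hc.eventually (S.transition ψ hψ φ' hφ' (f p) hq hp')]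
    with q h1 h2 h3
  rw [Function.comp_apply, Function.comp_apply, h2, h3, h1, planeAct_mul]

theorem IsParamAt.congr {g h : ℂ → X} {z c : ℂ} (hh : S.IsParamAt h (z - c))
    (he : ∀ᶠ w in 𝓝 z, g w = h (w - c)) : S.IsParamAt g z := by
  obtain ⟨hc, φ, hφ, hs, hev⟩ := hh
  have ht : ContinuousAt (fun w : ℂ => w - c) z := by fun_prop
  have hz : g z = h (z - c) := he.self_of_nhds
  refine ⟨(ContinuousAt.comp (f := fun w : ℂ => w - c) hc ht).congr (Filter.EventuallyEq.symm he), φ, hφ,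
    by rwa [hz], ?_⟩
  filter_upwards [he, ht.eventually hev] with w h1 h2
  rw [h1, hz, h2, sub_sub_sub_cancel_right]

theorem locallyAffineAt_of_isParamAt {f : X → X} {A : SL(2, ℝ)} {g g' : ℂ → X} {z z' : ℂ}
    (hg : S.IsParamAt g z) (hg' : S.IsParamAt g' z')
    (h : ∀ᶠ w in 𝓝 z, f (g w) = g' (z' + planeAct A (w - z))) :
    S.LocallyAffineAt f A (g z) := by
  obtain ⟨hc, φ, hφ, hs, he⟩ := hg
  obtain ⟨hc', ψ, hψ, hs', he'⟩ := hg'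
  have hfz : f (g z) = g' z' := by simpa [planeAct_zero] using h.self_of_nhds
  refine ⟨φ, hφ, ψ, hψ, hs, by rwa [hfz], ?_⟩
  have hsrc : ∀ᶠ w in 𝓝 z, g w ∈ φ.source := hc.eventually (φ.open_source.mem_nhds hs)
  have hA : Filter.Tendsto (fun w => z' + planeAct A (w - z)) (𝓝 z) (𝓝 z') := by
    have : Continuous fun w => z' + planeAct A (w - z) :=
      continuous_const.add ((continuous_planeAct A).comp (continuous_id.sub continuous_const))
    simpa [planeAct_zero] using this.tendsto z
  have ht : Filter.Tendsto (fun q => z + (φ q - φ (g z))) (𝓝 (g z)) (𝓝 z) := by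
    have : ContinuousAt (fun q => z + (φ q - φ (g z))) (g z) :=
      continuousAt_const.add ((φ.continuousAt hs).sub continuousAt_const)
    simpa [ContinuousAt] using this
  filter_upwards [ht.eventually hsrc, ht.eventually he, ht.eventually h,
    ht.eventually (hA.eventually he'), φ.open_source.mem_nhds hs] with q h1 h2 h3 h4 h5
  have hq : g (z + (φ q - φ (g z))) = q := by
    refine φ.injOn h1 h5 ?_
    linear_combination h2
  rw [hq] at h3
  rw [h3, hfz, h4]
  simp

end TranslationStructure

namespace DoubleHeptagon

theorem isParamAt_param {u z : ℂ} (hu : u ^ 7 = 1) (hz : z ∈ dom u) :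
    structureOn.IsParamAt (param u) z := by
  have inv : ∀ x ∈ dom u, (invChart u hu).symm (param u x) = x :=
    fun x hx => (invChart u hu).left_inv hx
  refine ⟨(continuousOn_param hu).continuousAt ((isOpen_dom u).mem_nhds hz),
    (invChart u hu).symm, ⟨u, hu, rfl⟩, ⟨z, hz, rfl⟩, ?_⟩
  filter_upwards [(isOpen_dom u).mem_nhds hz] with w hw
  rw [inv w hw, inv z hz]

/-! ### Rotations -/

theorem dot_mul {η : ℂ} (hη : η ^ 7 = -1) (u z : ℂ) : dot (η * u) (η * z) = dot u z := by
  have h : (-η) ^ 7 = 1 := by rw [Odd.neg_pow (by decide), hη, neg_neg]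
  have h1 := norm_root h
  simp only [Complex.neg_re, Complex.neg_im, neg_sq] at h1
  simp only [dot, Complex.mul_re, Complex.mul_im]
  linear_combination (u.re * z.re + u.im * z.im) * h1

theorem dot_neg_left (u z : ℂ) : dot (-u) z = -dot u z := by
  simp [dot]; ring

theorem neg_mul_pow {η u : ℂ} (hη : η ^ 7 = -1) (hu : u ^ 7 = 1) : (-(η * u)) ^ 7 = 1 := by
  rw [Odd.neg_pow (by decide), mul_pow, hη, hu]; norm_num

theorem inv_pow_seven {η : ℂ} (hη : η ^ 7 = -1) : η⁻¹ ^ 7 = -1 := by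
  rw [inv_pow, hη]; norm_num

theorem ne_zero_of_pow {η : ℂ} (hη : η ^ 7 = -1) : η ≠ 0 := by
  rintro rfl; norm_num at hη

/-- `η * z` satisfies the inequalities of the second heptagon if `z` satisfies those of the first,
and conversely: multiplication by `-η⁻¹` permutes the normals. -/
theorem dot_mul_right {η : ℂ} (hη : η ^ 7 = -1) (u z : ℂ) :
    dot u (η * z) = -dot (-(η⁻¹ * u)) z := by
  have h := dot_mul hη (η⁻¹ * u) z
  rw [mul_inv_cancel_left₀ (ne_zero_of_pow hη)] at h
  rw [h, dot_neg_left, neg_neg]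

theorem mul_mem_oppHeptagon {η z : ℂ} (hη : η ^ 7 = -1) (hz : z ∈ heptagon) :
    η * z ∈ oppHeptagon := by
  intro u hu
  rw [dot_mul_right hη]
  linarith [hz _ (neg_mul_pow (inv_pow_seven hη) hu)]

theorem mul_mem_heptagon {η z : ℂ} (hη : η ^ 7 = -1) (hz : z ∈ oppHeptagon) :
    η * z ∈ heptagon := by
  intro u hu
  rw [dot_mul_right hη]
  linarith [hz _ (neg_mul_pow (inv_pow_seven hη) hu)]

/-- Multiplication by a root `η` of `η ^ 7 = -1`, exchanging the two heptagons. -/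
noncomputable def piecesRotation (η : ℂ) (hη : η ^ 7 = -1) : Pieces → Pieces
  | Sum.inl z => Sum.inr ⟨η * z, mul_mem_oppHeptagon hη z.2⟩
  | Sum.inr z => Sum.inl ⟨η * z, mul_mem_heptagon hη z.2⟩

theorem continuous_piecesRotation {η : ℂ} (hη : η ^ 7 = -1) :
    Continuous (piecesRotation η hη) := by
  refine continuous_sum_dom.2 ⟨?_, ?_⟩
  · exact continuous_inr.comp ((continuous_const.mul continuous_subtype_val).subtype_mk _)
  · exact continuous_inl.comp ((continuous_const.mul continuous_subtype_val).subtype_mk _)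

theorem glue_rotation {η : ℂ} (hη : η ^ 7 = -1) {x y : Pieces} (h : Glue x y) :
    Glue (piecesRotation η hη y) (piecesRotation η hη x) := by
  obtain ⟨u, hu, z, w, hz, hw⟩ := h
  refine Glue.mk (-(η * u)) (neg_mul_pow hη hu) _ _ ?_ ?_
  · simp only
    rw [dot_neg_left, dot_mul hη, hw, dot_sub hu, hz]; norm_num
  · simp only; rw [hw]; ring

/-- The self-map of the surface induced by the multiplication by a root `η` of `η ^ 7 = -1`. -/
noncomputable def rotation (η : ℂ) (hη : η ^ 7 = -1) : Surface → Surface :=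
  Quot.lift (fun x => proj (piecesRotation η hη x)) fun _ _ h =>
    (Quot.sound (glue_rotation hη h)).symm

theorem rotation_inl {η : ℂ} (hη : η ^ 7 = -1) {z : ℂ} (hz : z ∈ heptagon) :
    rotation η hη (proj (Sum.inl ⟨z, hz⟩)) =
      proj (Sum.inr ⟨η * z, mul_mem_oppHeptagon hη hz⟩) := rfl

theorem rotation_inr {η : ℂ} (hη : η ^ 7 = -1) {z : ℂ} (hz : z ∈ oppHeptagon) :
    rotation η hη (proj (Sum.inr ⟨z, hz⟩)) =
      proj (Sum.inl ⟨η * z, mul_mem_heptagon hη hz⟩) := rfl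

theorem continuous_rotation {η : ℂ} (hη : η ^ 7 = -1) : Continuous (rotation η hη) :=
  continuous_quot_lift _ (continuous_proj.comp (continuous_piecesRotation hη))

theorem rotation_rotation {η ξ : ℂ} (hη : η ^ 7 = -1) (hξ : ξ ^ 7 = -1) (h : η * ξ = 1)
    (p : Surface) : rotation η hη (rotation ξ hξ p) = p := by
  obtain ⟨x, rfl⟩ : ∃ x, proj x = p := Quot.exists_rep p
  rcases x with ⟨z, hz⟩ | ⟨z, hz⟩
  · rw [rotation_inl, rotation_inr]
    simp only [← mul_assoc, h, one_mul]
  · rw [rotation_inr, rotation_inl]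
    simp only [← mul_assoc, h, one_mul]

/-- The rotation as a homeomorphism of the surface. -/
noncomputable def rotationHomeo (η : ℂ) (hη : η ^ 7 = -1) : Surface ≃ₜ Surface where
  toFun := rotation η hη
  invFun := rotation η⁻¹ (inv_pow_seven hη)
  left_inv := rotation_rotation _ _ (inv_mul_cancel₀ (ne_zero_of_pow hη))
  right_inv := rotation_rotation _ _ (mul_inv_cancel₀ (ne_zero_of_pow hη))
  continuous_toFun := continuous_rotation hη
  continuous_invFun := continuous_rotation _

theorem isVertex_rotation {η : ℂ} (hη : η ^ 7 = -1) {x : Pieces} (hx : IsVertex x) :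
    IsVertex (piecesRotation η hη x) := by
  have hinj : ∀ {u v : ℂ}, u ≠ v → -(η * u) ≠ -(η * v) := fun huv h =>
    huv (mul_left_cancel₀ (ne_zero_of_pow hη) (neg_injective h))
  rcases x with z | z <;> obtain ⟨u, v, hu, hv, huv, h1, h2⟩ := hx <;>
    refine ⟨_, _, neg_mul_pow hη hu, neg_mul_pow hη hv, hinj huv, ?_, ?_⟩ <;>
    simp only [dot_neg_left, dot_mul hη, h1, h2, neg_neg]

theorem rotation_mem_singularSet {η : ℂ} (hη : η ^ 7 = -1) {p : Surface} (hp : p ∈ singularSet) :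
    rotation η hη p ∈ singularSet := by
  obtain ⟨x, hx, rfl⟩ := hp
  exact ⟨_, isVertex_rotation hη hx, rfl⟩

theorem rotation_mem_singularSet_iff {η : ℂ} (hη : η ^ 7 = -1) (p : Surface) :
    rotation η hη p ∈ singularSet ↔ p ∈ singularSet := by
  refine ⟨fun h => ?_, rotation_mem_singularSet hη⟩
  have h1 := rotation_mem_singularSet (inv_pow_seven hη) h
  rwa [rotation_rotation _ _ (inv_mul_cancel₀ (ne_zero_of_pow hη))] at h1

theorem mul_mem_dom {η u w : ℂ} (hη : η ^ 7 = -1) (hu : u ^ 7 = 1) (hw : w ∈ dom u) :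
    η * (w - 2 * u) ∈ dom (-(η * u)) := by
  have h0 := ne_zero_of_pow hη
  intro v hv hvu
  have hv' := neg_mul_pow (inv_pow_seven hη) hv
  have hne : -(η⁻¹ * v) ≠ u := by
    rintro rfl
    exact hvu (by field_simp)
  have e : η * (w - 2 * u) - 2 * -(η * u) = η * w := by ring
  rw [dot_neg_left, dot_mul hη, dot_sub hu, e, dot_mul_right hη, dot_mul_right hη]
  constructor
  · intro h
    linarith [(hw _ hv' hne).2 (by linarith)]
  · intro h
    linarith [(hw _ hv' hne).1 (by linarith)]

theorem rotation_param {η u w : ℂ} (hη : η ^ 7 = -1) (hu : u ^ 7 = 1) (hw : w ∈ dom u) :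
    rotation η hη (param u w) = param (-(η * u)) (η * (w - 2 * u)) := by
  have hv := neg_mul_pow hη hu
  rcases le_total (dot u w) 1 with h | h
  · have h1 := mem_left hw h
    have e : η * (w - 2 * u) - 2 * -(η * u) = η * w := by ring
    rw [param_of_mem_heptagon hu h1, rotation_inl, param_of_mem_oppHeptagon hv
      (by rw [e]; exact mul_mem_oppHeptagon hη h1)]
    simp only [e]
  · have h1 := mem_right hu hw h
    rw [param_of_mem_oppHeptagon hu h1, rotation_inr, param_of_mem_heptagon hv]

/-- The matrix of the rotation of angle `t`. -/
noncomputable def rotMatrix (t : ℝ) : SL(2, ℝ) :=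
  ⟨!![Real.cos t, -Real.sin t; Real.sin t, Real.cos t], by
    rw [Matrix.det_fin_two_of]; linear_combination Real.cos_sq_add_sin_sq t⟩

theorem planeAct_rotMatrix (t : ℝ) (z : ℂ) :
    planeAct (rotMatrix t) z = Complex.exp (t * Complex.I) * z := by
  apply Complex.ext
  · rw [Complex.mul_re, Complex.exp_ofReal_mul_I_re, Complex.exp_ofReal_mul_I_im]
    simp [planeAct, rotMatrix]; ring
  · rw [Complex.mul_im, Complex.exp_ofReal_mul_I_re, Complex.exp_ofReal_mul_I_im]
    simp [planeAct, rotMatrix]; ring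

theorem locallyAffineAt_rotation {t : ℝ} (ht : Complex.exp (t * Complex.I) ^ 7 = -1) {p : Surface}
    (hp : p ∉ singularSet) :
    structureOn.LocallyAffineAt (rotation _ ht) (rotMatrix t) p := by
  obtain ⟨u, hu, z, hz, rfl⟩ := covers hp
  refine TranslationStructure.locallyAffineAt_of_isParamAt (isParamAt_param hu hz)
    (isParamAt_param (neg_mul_pow ht hu) (mul_mem_dom ht hu hz)) ?_
  filter_upwards [(isOpen_dom u).mem_nhds hz] with w hw
  rw [rotation_param ht hu hw, planeAct_rotMatrix]
  congr 1; ring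

theorem rotMatrix_mem {t : ℝ} (ht : Complex.exp (t * Complex.I) ^ 7 = -1) :
    rotMatrix t ∈ veechGroup :=
  ⟨rotationHomeo _ ht, TranslationStructure.isAffine_of_locallyAffineAt
    (rotation_mem_singularSet_iff ht) fun _ hp => locallyAffineAt_rotation ht hp⟩

/-! ### The multi-twist is affine -/

theorem cyl_eq_param_normal {j : ℕ} (hj : j < 3) {w : ℂ} (hs : w ∈ strip j)
    (hw : w ∈ dom (normal (j + 1))) : cyl j w = param (normal (j + 1)) w := by
  have hu := normal_pow (j + 1)
  rcases le_total (dot (normal (j + 1)) w) 1 with h | h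
  · have h1 := mem_left hw h
    rw [cyl_inl hj hs h1, param_of_mem_heptagon hu h1]
  · have h1 := mem_right hu hw h
    have e : w - 2 * normal (j + 1) + 2 * normal (j + 1) = w := sub_add_cancel _ _
    have h2 := cyl_inr hj (by rw [e]; exact hs) h1
    rw [e] at h2
    rw [h2, param_of_mem_oppHeptagon hu h1]

theorem cyl_eq_param_conj {j : ℕ} (hj : j < 3) {w : ℂ} (hs : w ∈ strip j)
    (hw : w ∈ dom ((starRingEnd ℂ) (normal (j + 1)))) :
    cyl j w = param ((starRingEnd ℂ) (normal (j + 1))) w := by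
  have hu := conj_pow (normal_pow (j + 1))
  rcases le_total (dot ((starRingEnd ℂ) (normal (j + 1))) w) 1 with h | h
  · have h1 := mem_left hw h
    rw [cyl_inl hj hs h1, param_of_mem_heptagon hu h1]
  · have h1 := mem_right hu hw h
    have e : w - 2 * (starRingEnd ℂ) (normal (j + 1)) + 2 * normal (j + 1) =
        w + (((1 : ℤ) : ℝ) * circ j : ℝ) * Complex.I := by
      rw [conj_normal_eq]; push_cast; ring
    have h2 := cyl_inr hj (by rw [e]; exact mem_strip_of_re_eq hs (by simp)) h1
    rw [e, cyl_add_circ hj] at h2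
    rw [h2, param_of_mem_oppHeptagon hu h1]

/-- Over an open strip, `cyl j` is locally inverse to a chart across one of the two sides that bound
the strip. -/
theorem isParamAt_cyl {j : ℕ} (hj : j < 3) {z : ℂ} (hz : z ∈ openStrip j) :
    structureOn.IsParamAt (cyl j) z := by
  have hu := normal_pow (j + 1)
  have hc := conj_pow hu
  obtain ⟨n, w, hw, hlt, rfl⟩ := exists_band hj (openStrip_subset j hz)
  have hwo : w ∈ openStrip j := mem_openStrip_of_re_eq hz (by simp)
  suffices h : structureOn.IsParamAt (cyl j) w by
    refine TranslationStructure.IsParamAt.congr (c := (n * circ j : ℝ) * Complex.I)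
      (by rwa [add_sub_cancel_right]) (Filter.Eventually.of_forall fun x => ?_)
    rw [← cyl_add_circ hj (x - _) n, sub_add_cancel]
  have hopen := (isOpen_openStrip j).mem_nhds hwo
  -- It suffices that `w` lies in the domain of the chart across one of the two bounding sides.
  have hdom : ∀ v : ℂ, v ^ 7 = 1 → w ∈ dom v →
      (∀ x ∈ strip j, x ∈ dom v → cyl j x = param v x) → structureOn.IsParamAt (cyl j) w := by
    intro v hv hwv he
    refine TranslationStructure.IsParamAt.congr (c := 0) (h := param v)
      (by rw [sub_zero]; exact isParamAt_param hv hwv) ?_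
    filter_upwards [hopen, (isOpen_dom v).mem_nhds hwv] with x h1 h2
    rw [sub_zero, he x (openStrip_subset j h1) h2]
  have hlt1 : ∀ {x : ℂ}, x ∈ openStrip j → x ∈ heptagon → 0 < height j x → ∀ v : ℂ, v ^ 7 = 1 →
      v ≠ normal (j + 1) → dot v x < 1 := by
    intro x hx hxH h0 v hv hvu
    by_cases hvc : v = (starRingEnd ℂ) (normal (j + 1))
    · rw [height, ← hvc] at h0; linarith
    · exact dot_lt_one hj hx (mem_heptagon_iff.1 hxH _ hj) hv hvu hvc
  rcases hw.2.1.eq_or_lt with h0 | h0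
  · have hd := dot_le_one_of_height_eq_zero hj hw.1 h0.symm
    have hH := mem_heptagon_of_height hj hw.1 hw.2.1 hd
    refine hdom _ hc (mem_dom_left hc hH fun v hv hvc => ?_) fun x => cyl_eq_param_conj hj
    by_cases hvu : v = normal (j + 1)
    · have h1 := co_mul_re_lt hj hwo
      rw [height_eq] at h0
      rw [hvu, dot_normal]; linarith
    · exact dot_lt_one hj hwo (mem_heptagon_iff.1 hH _ hj) hv hvu hvc
  · refine hdom _ hu ?_ fun x => cyl_eq_param_normal hj
    rcases band_cases hj hw with h | h
    · exact mem_dom_left hu h (hlt1 hwo h h0)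
    · refine mem_dom_right hu h fun v hv hvu => ?_
      have h1 := hlt1 (reflect_mem_openStrip hwo) (reflect_mem_heptagon_iff.2 h)
        (by rw [height_reflect]; linarith) v hv hvu
      rw [← neg_sub, dot_neg] at h1
      linarith

/-- The derivative of the multi-twist. -/
noncomputable def twistMatrix : SL(2, ℝ) :=
  ⟨!![1, 0; slope, 1], by rw [Matrix.det_fin_two_of]; ring⟩

theorem shear_add_planeAct (x₀ : ℝ) (z w : ℂ) :
    shear slope x₀ z + planeAct twistMatrix (w - z) = shear slope x₀ w := by
  apply Complex.ext
  · simp [shear, planeAct, twistMatrix]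
  · simp [shear, planeAct, twistMatrix]; ring

theorem locallyAffineAt_twist_cyl {j : ℕ} (hj : j < 3) {z : ℂ} (hz : z ∈ openStrip j) :
    structureOn.LocallyAffineAt (twist 1) twistMatrix (cyl j z) := by
  refine TranslationStructure.locallyAffineAt_of_isParamAt (isParamAt_cyl hj hz)
    (isParamAt_cyl hj (z := shear slope (wall (j + 1)) z)
      (mem_openStrip_of_re_eq hz (shear_re _ _ _))) ?_
  filter_upwards [(isOpen_openStrip j).mem_nhds hz] with w hw
  rw [twist_cyl 1 hj (openStrip_subset j hw), shear_add_planeAct, Int.cast_one, one_mul]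

/-- Next to a wall that is the right end of a strip, the twist is the shear that fixes the wall. -/
theorem twist_inl_left {m : ℕ} (hm : m < 3) {w : ℂ} (hs : w ∈ strip m) (hw : w ∈ heptagon)
    (hw' : shear slope (wall m) w ∈ heptagon) :
    twist 1 (proj (Sum.inl ⟨w, hw⟩)) = proj (Sum.inl ⟨_, hw'⟩) := by
  rw [twist_proj, piecesTwist_inl 1 hm ⟨w, hw⟩ hs, cyl_shear_left hm, Int.cast_one, one_mul,
    cyl_inl hm (shear_mem_strip hs) hw']

/-- Next to a wall that is the left end of a strip, the twist is the shear that fixes the wall. -/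
theorem twist_inl_right {m : ℕ} (hm : m < 3) {w : ℂ} (hs : w ∈ strip m) (hw : w ∈ heptagon)
    (hw' : shear slope (wall (m + 1)) w ∈ heptagon) :
    twist 1 (proj (Sum.inl ⟨w, hw⟩)) = proj (Sum.inl ⟨_, hw'⟩) := by
  rw [twist_proj, piecesTwist_inl 1 hm ⟨w, hw⟩ hs, Int.cast_one, one_mul,
    cyl_inl hm (shear_mem_strip hs) hw']

theorem shear_eq_self {s x₀ : ℝ} {z : ℂ} (h : z.re = x₀) : shear s x₀ z = z := by
  simp [shear, h]

/-- If the twist is the shear fixing the line of abscissa `x₀` in the chart across the vertical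
side, then it is affine at the points of that line. -/
theorem locallyAffineAt_twist_of_shear {x₀ : ℝ} {z : ℂ} (hz : z ∈ dom 1) (hre : z.re = x₀)
    (h : ∀ᶠ w in 𝓝 z, shear slope x₀ w ∈ dom 1 →
      twist 1 (param 1 w) = param 1 (shear slope x₀ w)) :
    structureOn.LocallyAffineAt (twist 1) twistMatrix (param 1 z) := by
  refine TranslationStructure.locallyAffineAt_of_isParamAt (isParamAt_param (one_pow 7) hz)
    (isParamAt_param (one_pow 7) hz) ?_
  have hc : ∀ᶠ w in 𝓝 z, shear slope x₀ w ∈ dom 1 := by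
    apply (continuous_shear slope x₀).continuousAt.eventually
    rw [shear_eq_self hre]
    exact (isOpen_dom 1).mem_nhds hz
  filter_upwards [h, hc] with w h1 h2
  have e := shear_add_planeAct x₀ z w
  rw [shear_eq_self hre] at e
  rw [h1 h2, e]

theorem dot_one (z : ℂ) : dot 1 z = z.re := by simp [dot]

theorem eventually_re_gt {z : ℂ} {c : ℝ} (h : c < z.re) : ∀ᶠ w in 𝓝 z, c < w.re :=
  (isOpen_lt continuous_const Complex.continuous_re).mem_nhds h

theorem eventually_re_lt {z : ℂ} {c : ℝ} (h : z.re < c) : ∀ᶠ w in 𝓝 z, w.re < c :=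
  (isOpen_lt Complex.continuous_re continuous_const).mem_nhds h

theorem locallyAffineAt_twist_side {z : heptagon} (hz : ¬ IsVertex (Sum.inl z))
    (hre : (z : ℂ).re = 1) :
    structureOn.LocallyAffineAt (twist 1) twistMatrix (proj (Sum.inl z)) := by
  have h1 : (1 : ℂ) ^ 7 = 1 := one_pow 7
  have hd : (z : ℂ) ∈ dom 1 := mem_dom_left h1 z.2 fun v hv hv1 =>
    lt_of_le_of_ne (z.2 v hv) fun he => hz ⟨v, 1, hv, h1, hv1, he, by rw [dot_one, hre]⟩
  have h03 : 0 < 3 := by norm_num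
  have hw01 : wall 1 < 1 := wall_zero ▸ wall_succ_lt h03
  have hwa := wall_add 0
  rw [wall_zero, zero_add] at hwa
  have e := param_of_mem_heptagon h1 z.2
  rw [Subtype.coe_eta] at e
  rw [← e]
  refine locallyAffineAt_twist_of_shear hd hre ?_
  filter_upwards [(isOpen_dom 1).mem_nhds hd, eventually_re_gt (hre.symm ▸ hw01),
    eventually_re_lt (c := 2 - wall 1) (z := z) (by rw [hre]; linarith)] with w hw h3 h4 hw'
  rcases le_total w.re 1 with h5 | h5
  · have hH := mem_left hw (by rw [dot_one]; exact h5)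
    have hH' := mem_left hw' (by rw [dot_one, shear_re]; exact h5)
    have hs : w ∈ strip 0 := ⟨h3.le, by rw [wall_zero]; exact h5⟩
    rw [param_of_mem_heptagon h1 hH, param_of_mem_heptagon h1 hH']
    have := twist_inl_left h03 hs hH (by rw [wall_zero]; exact hH')
    rw [this]; simp only [wall_zero]
  · have hO := mem_right h1 hw (by rw [dot_one]; exact h5)
    have hO' := mem_right h1 hw' (by rw [dot_one, shear_re]; exact h5)
    have hs : w - 2 * 1 + 2 * normal (0 + 1) ∈ strip 0 := by
      rw [add_normal_mem_strip, wall_zero]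
      simp
      constructor <;> linarith
    have e1 : shear slope (wall (0 + 1)) (w - 2 * 1 + 2 * normal (0 + 1)) =
        shear slope 1 w - 2 * 1 + 2 * normal (0 + 1) := by
      have : (w - 2 * 1 + 2 * normal (0 + 1)).re - wall (0 + 1) = w.re - 1 := by
        simp [normal]; linarith
      rw [shear, this, shear]; ring
    have hs' : shear slope 1 w - 2 * 1 + 2 * normal (0 + 1) ∈ strip 0 := e1 ▸ shear_mem_strip hs
    rw [param_of_mem_oppHeptagon h1 hO, param_of_mem_oppHeptagon h1 hO', twist_proj,
      piecesTwist_inr 1 h03 ⟨_, hO⟩ hs, Int.cast_one, one_mul]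
    simp only
    rw [e1, cyl_inr h03 hs' hO']

theorem normal_ne_succ (m : ℕ) : normal m ≠ normal (m + 1) := by
  intro h
  have h1 : co m = co (m + 1) := (Complex.ext_iff.1 h).1
  have h2 : si m = si (m + 1) := (Complex.ext_iff.1 h).2
  have h3 := si_one_eq m
  rw [h1, h2] at h3
  have := si_pos one_pos (by norm_num)
  linarith

/-- A nonsingular point of the heptagon on one of the two vertical diagonals is an interior point
of the heptagon. -/
theorem dot_lt_one_of_diagonal {m : ℕ} (h0 : 0 < m) (hm : m < 3) {z : heptagon}
    (hz : ¬ IsVertex (Sum.inl z)) (hre : (z : ℂ).re = wall m) {v : ℂ} (hv : v ^ 7 = 1) :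
    dot v z < 1 := by
  have hl := mem_heptagon_iff.1 z.2
  have hstep := level_step m z
  rw [hre, sub_self, mul_zero, add_zero] at hstep
  have hm1 : level m z < 1 := by
    refine lt_of_le_of_ne (hl m hm.le) fun he => hz ?_
    rw [he, sub_self, mul_zero] at hstep
    have he' : level (m + 1) z = 1 := by
      have := (mul_eq_zero.1 hstep.symm).resolve_left (si_pos h0 hm.le).ne'
      linarith
    rw [level] at he he'
    rcases le_total 0 (z : ℂ).im with him | him
    · rw [abs_of_nonneg him] at he he'
      exact ⟨_, _, normal_pow m, normal_pow (m + 1), normal_ne_succ m, he, he'⟩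
    · rw [abs_of_nonpos him] at he he'
      refine ⟨_, _, conj_pow (normal_pow m), conj_pow (normal_pow (m + 1)),
        (starRingEnd ℂ).injective.ne (normal_ne_succ m), ?_, ?_⟩ <;> rw [dot_conj_normal] <;>
        linarith
  have hm2 : level (m + 1) z < 1 := by
    have h1 := mul_pos (si_pos (Nat.succ_pos m) hm) (sub_pos.2 hm1)
    rw [hstep] at h1
    linarith [(mul_pos_iff_of_pos_left (si_pos h0 hm.le)).1 h1]
  have hall : ∀ k ≤ 3, level k z < 1 := by
    intro k hk
    have hdown : ∀ i, i < m → level (i + 1) z < 1 → level i z < 1 := fun i hi h =>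
      level_lt_of_succ (by omega) (hre.trans_lt (wall_lt hm.le hi)) h.le
    have hup : ∀ i, m < i → i < 3 → level i z < 1 → level (i + 1) z < 1 := fun i hi hi3 h =>
      level_succ_lt (by omega) hi3 ((wall_lt hi3.le hi).trans_eq hre.symm) h.le
    rcases le_or_gt k m with h | h
    · induction h using Nat.decreasingInduction with
      | self => exact hm1
      | of_succ i hi ih => exact hdown i hi (ih (by omega))
    · induction k, h using Nat.le_induction with
      | base => exact hm2
      | succ i hi ih => exact hup i hi hk (ih (by omega))
  obtain ⟨k, hk, hvk⟩ := eq_normal hv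
  have := (level_lt_iff hk).1 (hall k hk)
  rcases hvk with rfl | rfl
  · exact this.1
  · exact this.2

theorem locallyAffineAt_twist_diagonal {m : ℕ} (hm : m + 1 < 3) {z : heptagon}
    (hz : ¬ IsVertex (Sum.inl z)) (hre : (z : ℂ).re = wall (m + 1)) :
    structureOn.LocallyAffineAt (twist 1) twistMatrix (proj (Sum.inl z)) := by
  have h1 : (1 : ℂ) ^ 7 = 1 := one_pow 7
  have hlt : ∀ v : ℂ, v ^ 7 = 1 → dot v z < 1 := fun v hv =>
    dot_lt_one_of_diagonal (Nat.succ_pos m) hm hz hre hv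
  have hd : (z : ℂ) ∈ dom 1 := mem_dom_left h1 z.2 fun v hv _ => hlt v hv
  have hz1 : (z : ℂ).re < 1 := by rw [← dot_one]; exact hlt 1 h1
  have e := param_of_mem_heptagon h1 z.2
  rw [Subtype.coe_eta] at e
  rw [← e]
  refine locallyAffineAt_twist_of_shear hd hre ?_
  filter_upwards [(isOpen_dom 1).mem_nhds hd, eventually_re_lt hz1,
    eventually_re_gt (hre.symm ▸ wall_succ_lt hm),
    eventually_re_lt (hre.symm ▸ wall_succ_lt (m := m) (by omega))] with w hw h2 h3 h4 hw'
  have hH := mem_left hw (by rw [dot_one]; exact h2.le)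
  have hH' := mem_left hw' (by rw [dot_one, shear_re]; exact h2.le)
  rw [param_of_mem_heptagon h1 hH, param_of_mem_heptagon h1 hH']
  rcases le_total w.re (wall (m + 1)) with h5 | h5
  · exact twist_inl_left hm ⟨h3.le, h5⟩ hH hH'
  · exact twist_inl_right (by omega) ⟨h5, h4.le⟩ hH hH'

theorem isVertex_of_re_eq_wall_three {z : heptagon} (h : (z : ℂ).re = wall 3) :
    IsVertex (Sum.inl z) := by
  have hl := mem_heptagon_iff.1 z.2 3 le_rfl
  have h1 : co 3 * wall 3 = 1 := by
    have h1 : co 3 = -Real.cos (Real.pi / 7) := by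
      rw [← Real.cos_pi_sub, co]; congr 1; push_cast; ring
    rw [h1]; linarith [wall_three_mul_cos]
  have h2 := si_pos (m := 3) (by norm_num) le_rfl
  rw [level, h, h1] at hl
  have h3 : |(z : ℂ).im| = 0 := by
    have : si 3 * |(z : ℂ).im| ≤ 0 := by linarith
    exact le_antisymm (by_contra fun hn => absurd this
      (not_le.2 (mul_pos h2 (not_le.1 hn)))) (abs_nonneg _)
  have h4 := abs_eq_zero.1 h3
  refine ⟨normal 3, (starRingEnd ℂ) (normal 3), normal_pow 3, conj_pow (normal_pow 3), ?_, ?_, ?_⟩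
  · intro he
    have : si 3 = -si 3 := congrArg Complex.im he
    linarith
  · rw [dot_normal, h, h1, h4]; simp
  · rw [dot_conj_normal, h, h1, h4]; simp

theorem locallyAffineAt_twist_inl {z : heptagon} (hz : ¬ IsVertex (Sum.inl z)) :
    structureOn.LocallyAffineAt (twist 1) twistMatrix (proj (Sum.inl z)) := by
  obtain ⟨j, hj, hs⟩ := exists_strip (wall_three_le_re z.2) (re_le_one z.2)
  have hwall : ∀ m ≤ 3, (z : ℂ).re = wall m →
      structureOn.LocallyAffineAt (twist 1) twistMatrix (proj (Sum.inl z)) := by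
    intro m hm hre
    rcases m with _ | m
    · exact locallyAffineAt_twist_side hz (hre.trans wall_zero)
    · rcases hm.lt_or_eq with hm | hm
      · exact locallyAffineAt_twist_diagonal hm hz hre
      · exact (hz (isVertex_of_re_eq_wall_three (hm ▸ hre))).elim
  by_cases ho : (z : ℂ) ∈ openStrip j
  · have := locallyAffineAt_twist_cyl hj ho
    rwa [cyl_inl hj hs z.2] at this
  · rcases eq_wall_of_not_openStrip hs ho with h | h
    · exact hwall _ hj h
    · exact hwall _ hj.le h

theorem exp_pi_pow : Complex.exp ((Real.pi : ℝ) * Complex.I) ^ 7 = -1 := by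
  rw [Complex.exp_pi_mul_I]; norm_num

theorem rotation_pi_cyl {j : ℕ} (hj : j < 3) {z : ℂ} (hz : z ∈ strip j) :
    rotation _ exp_pi_pow (cyl j z) = cyl j (2 * normal (j + 1) - z) := by
  obtain ⟨n, w, hw, _, rfl⟩ := exists_band hj hz
  have e : 2 * normal (j + 1) - (w + (n * circ j : ℝ) * Complex.I) =
      2 * normal (j + 1) - w + ((-n : ℤ) * circ j : ℝ) * Complex.I := by push_cast; ring
  rw [e, cyl_add_circ hj, cyl_add_circ hj]
  have hs := reflect_mem_strip hw.1
  rcases band_cases hj hw with h | h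
  · have e1 : 2 * normal (j + 1) - w =
        Complex.exp ((Real.pi : ℝ) * Complex.I) * w + 2 * normal (j + 1) := by
      rw [Complex.exp_pi_mul_I]; ring
    rw [e1] at hs ⊢
    rw [cyl_inl hj hw.1 h, rotation_inl, cyl_inr hj hs]
  · have e0 : w - 2 * normal (j + 1) + 2 * normal (j + 1) = w := sub_add_cancel _ _
    have h2 := cyl_inr hj (by rw [e0]; exact hw.1) h
    rw [e0] at h2
    have e1 : 2 * normal (j + 1) - w =
        Complex.exp ((Real.pi : ℝ) * Complex.I) * (w - 2 * normal (j + 1)) := by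
      rw [Complex.exp_pi_mul_I]; ring
    rw [e1] at hs ⊢
    rw [h2, rotation_inr, cyl_inl hj hs]

/-- The multi-twist commutes with the central symmetry. -/
theorem twist_rotation_pi (p : Surface) :
    twist 1 (rotation _ exp_pi_pow p) = rotation _ exp_pi_pow (twist 1 p) := by
  obtain ⟨j, hj, z, hz, rfl⟩ := exists_cyl p
  rw [rotation_pi_cyl hj hz, twist_cyl 1 hj (reflect_mem_strip hz), twist_cyl 1 hj hz,
    rotation_pi_cyl hj (shear_mem_strip hz), cyl_shear_left hj]
  congr 1
  have h := wall_add j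
  have e : (2 * normal (j + 1) - z).re - wall j = -(z.re - wall (j + 1)) := by
    simp [normal]; linarith
  rw [shear, e, shear]; push_cast; ring

theorem rotMatrix_pi_conj : rotMatrix Real.pi * (twistMatrix * rotMatrix Real.pi) = twistMatrix := by
  apply Subtype.ext
  rw [Matrix.SpecialLinearGroup.coe_mul, Matrix.SpecialLinearGroup.coe_mul]
  simp [rotMatrix, twistMatrix]

theorem twistMatrix_mem : twistMatrix ∈ veechGroup := by
  refine ⟨twistHomeo, TranslationStructure.isAffine_of_locallyAffineAt
    twist_mem_singularSet_iff fun p hp => ?_⟩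
  change p ∉ singularSet at hp
  obtain ⟨z | z, rfl⟩ : ∃ x, proj x = p := Quot.exists_rep p
  · exact locallyAffineAt_twist_inl fun hv => hp ⟨_, hv, rfl⟩
  · -- the central symmetry carries the point into the first heptagon
    set ρ := rotation _ exp_pi_pow with hρ
    have hconj : (twistHomeo : Surface → Surface) = ρ ∘ (twist 1 ∘ ρ) := by
      funext q
      change twist 1 q = ρ (twist 1 (ρ q))
      rw [hρ, ← twist_rotation_pi, rotation_rotation]
      rw [Complex.exp_pi_mul_I]; norm_num
    have hq : ρ (proj (Sum.inr z)) ∉ singularSet := by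
      rwa [hρ, rotation_mem_singularSet_iff]
    have h1 : structureOn.LocallyAffineAt (twist 1) twistMatrix (ρ (proj (Sum.inr z))) :=
      locallyAffineAt_twist_inl fun hv => hq ⟨_, hv, rfl⟩
    have hr : Continuous ρ := continuous_rotation exp_pi_pow
    have h2 := h1.comp (locallyAffineAt_rotation exp_pi_pow hp) hr.continuousAt
    have h3 : (twist 1 ∘ ρ) (proj (Sum.inr z)) ∉ singularSet := by
      intro h
      exact hq ((twist_mem_singularSet_iff _).1 h)
    have h4 := (locallyAffineAt_rotation exp_pi_pow h3).comp h2
      ((continuous_twist 1).comp hr).continuousAt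
    rw [rotMatrix_pi_conj] at h4
    rw [hconj]; exact h4

/-! ### The matrices in staircase coordinates -/

theorem exp_pi_div_seven_pow : Complex.exp ((Real.pi / 7 : ℝ) * Complex.I) ^ 7 = -1 := by
  rw [← Complex.exp_nat_mul, ← Complex.exp_pi_mul_I]
  congr 1; push_cast; ring

theorem fin_two_congr {a b c d a' b' c' d' : ℝ} (h1 : a = a') (h2 : b = b') (h3 : c = c')
    (h4 : d = d') : !![a, b; c, d] = !![a', b'; c', d'] := by
  rw [h1, h2, h3, h4]

theorem rotMatrix_mul (s t : ℝ) : rotMatrix s * rotMatrix t = rotMatrix (s + t) := by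
  apply Subtype.ext
  rw [Matrix.SpecialLinearGroup.coe_mul]
  simp only [rotMatrix, Matrix.mul_fin_two, Real.cos_add, Real.sin_add]
  refine fin_two_congr ?_ ?_ ?_ ?_ <;> ring

/-- `T` conjugates the matrix `A` into the Veech group. -/
def ConjMem (T A : Matrix (Fin 2) (Fin 2) ℝ) : Prop :=
  ∃ B ∈ veechGroup, (B : Matrix (Fin 2) (Fin 2) ℝ) * T = T * A

theorem ConjMem.mul {T A A' : Matrix (Fin 2) (Fin 2) ℝ} (h : ConjMem T A) (h' : ConjMem T A') :
    ConjMem T (A * A') := by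
  obtain ⟨B, hB, e⟩ := h
  obtain ⟨B', hB', e'⟩ := h'
  refine ⟨B * B', mul_mem hB hB', ?_⟩
  rw [Matrix.SpecialLinearGroup.coe_mul, Matrix.mul_assoc, e', ← Matrix.mul_assoc, e,
    Matrix.mul_assoc]

theorem ConjMem.inv {T A A' : Matrix (Fin 2) (Fin 2) ℝ} (h : ConjMem T A) (hA : A * A' = 1) :
    ConjMem T A' := by
  obtain ⟨B, hB, e⟩ := h
  refine ⟨B⁻¹, inv_mem hB, ?_⟩
  have h1 : ((B⁻¹ : SL(2, ℝ)) : Matrix (Fin 2) (Fin 2) ℝ) * (B : Matrix (Fin 2) (Fin 2) ℝ) = 1 := by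
    rw [← Matrix.SpecialLinearGroup.coe_mul, inv_mul_cancel, Matrix.SpecialLinearGroup.coe_one]
  calc ((B⁻¹ : SL(2, ℝ)) : Matrix (Fin 2) (Fin 2) ℝ) * T
      = (B⁻¹ : SL(2, ℝ)) * (T * A * A') := by rw [Matrix.mul_assoc, hA, Matrix.mul_one]
    _ = T * A' := by rw [← e, ← Matrix.mul_assoc, ← Matrix.mul_assoc, h1, Matrix.one_mul]

theorem ConjMem.exists_eq {T A : Matrix (Fin 2) (Fin 2) ℝ} (hT : IsUnit T.det)
    (h : ConjMem T A) :
    ∃ B ∈ veechGroup, (B : Matrix (Fin 2) (Fin 2) ℝ) = T * A * T⁻¹ := by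
  obtain ⟨B, hB, e⟩ := h
  exact ⟨B, hB, by rw [← e, Matrix.mul_nonsing_inv_cancel_right _ _ hT]⟩

/-- The matrix whose columns are the directions of two sides of the heptagon: it sends the
coordinates of the staircase model to those of the plane. -/
noncomputable def staircase : Matrix (Fin 2) (Fin 2) ℝ :=
  !![Real.cos (Real.pi / 7) + 1, Real.cos (Real.pi / 7) + 1;
    -Real.sin (Real.pi / 7), Real.sin (Real.pi / 7)]

theorem isUnit_det_staircase : IsUnit staircase.det := by
  rw [staircase, Matrix.det_fin_two_of, isUnit_iff_ne_zero]
  have := cos_pos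
  have := sin_pos
  apply ne_of_gt
  nlinarith [mul_pos cos_pos sin_pos]

theorem cos_sq_add_sin_sq : Real.cos (Real.pi / 7) ^ 2 + Real.sin (Real.pi / 7) ^ 2 = 1 :=
  Real.cos_sq_add_sin_sq _

theorem conjMem_rotation :
    ConjMem staircase !![0, -1; 1, 2 * Real.cos (Real.pi / 7)] := by
  refine ⟨_, rotMatrix_mem exp_pi_div_seven_pow, ?_⟩
  have h := cos_sq_add_sin_sq
  simp only [rotMatrix, staircase, Matrix.mul_fin_two]
  refine fin_two_congr ?_ ?_ ?_ ?_
  · linear_combination h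
  · linear_combination -h
  · ring
  · ring

theorem conjMem_parabolic :
    ConjMem staircase !![1, 2 * Real.cos (Real.pi / 7); 0, 1] := by
  set R : SL(2, ℝ) := rotMatrix (4 * (Real.pi / 7)) with hR
  have hRm : R ∈ veechGroup := by
    have h1 := rotMatrix_mem exp_pi_div_seven_pow
    have h2 : R = rotMatrix (Real.pi / 7) * rotMatrix (Real.pi / 7) *
        (rotMatrix (Real.pi / 7) * rotMatrix (Real.pi / 7)) := by
      rw [rotMatrix_mul, rotMatrix_mul, hR]; congr 1; ring
    rw [h2]
    exact mul_mem (mul_mem h1 h1) (mul_mem h1 h1)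
  refine ⟨R⁻¹ * twistMatrix⁻¹ * R,
    mul_mem (mul_mem (inv_mem hRm) (inv_mem twistMatrix_mem)) hRm, ?_⟩
  -- the rotation by `4π/7` makes the first column of `T` vertical
  have hvert : Real.cos (4 * (Real.pi / 7)) * (Real.cos (Real.pi / 7) + 1) +
      Real.sin (4 * (Real.pi / 7)) * Real.sin (Real.pi / 7) = 0 := by
    have h1 : 4 * (Real.pi / 7) - Real.pi / 7 = Real.pi - 4 * (Real.pi / 7) := by ring
    have h2 := Real.cos_sub (4 * (Real.pi / 7)) (Real.pi / 7)
    rw [h1, Real.cos_pi_sub] at h2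
    linarith
  have hs := sin_pos.ne'
  have hcs := cos_sq_add_sin_sq
  have key : (R : Matrix (Fin 2) (Fin 2) ℝ) *
      (staircase * !![1, 2 * Real.cos (Real.pi / 7); 0, 1]) =
      ((twistMatrix⁻¹ : SL(2, ℝ)) : Matrix (Fin 2) (Fin 2) ℝ) * (R * staircase) := by
    rw [Matrix.SpecialLinearGroup.coe_inv, Matrix.adjugate_fin_two]
    simp only [hR, rotMatrix, twistMatrix, staircase, slope, Matrix.mul_fin_two, Matrix.of_apply,
      Matrix.cons_val', Matrix.cons_val_zero, Matrix.cons_val_one, Matrix.cons_val_fin_one]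
    generalize Real.cos (4 * (Real.pi / 7)) = C at hvert ⊢
    generalize Real.sin (4 * (Real.pi / 7)) = S at hvert ⊢
    generalize Real.cos (Real.pi / 7) = c at hvert hcs ⊢
    generalize Real.sin (Real.pi / 7) = s at hvert hcs hs ⊢
    refine fin_two_congr ?_ ?_ ?_ ?_
    · ring
    · linear_combination (2 * c) * hvert
    · field_simp
      linear_combination (2 * c) * hvert
    · field_simp
      linear_combination (2 * c * c) * hvert - 2 * c * C * hcs
  calc _ = ((R⁻¹ : SL(2, ℝ)) : Matrix (Fin 2) (Fin 2) ℝ) *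
        (((twistMatrix⁻¹ : SL(2, ℝ)) : Matrix (Fin 2) (Fin 2) ℝ) * (R * staircase)) := by
        simp only [Matrix.SpecialLinearGroup.coe_mul, Matrix.mul_assoc]
    _ = _ := by
        rw [← key, ← Matrix.mul_assoc, ← Matrix.SpecialLinearGroup.coe_mul, inv_mul_cancel,
          Matrix.SpecialLinearGroup.coe_one, Matrix.one_mul]

/-- The minimal equation of `2 cos (π/7)`. -/
theorem two_cos_cubic : (2 * Real.cos (Real.pi / 7)) ^ 3 - (2 * Real.cos (Real.pi / 7)) ^ 2 -
    2 * (2 * Real.cos (Real.pi / 7)) + 1 = 0 := by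
  have h3 := Real.cos_three_mul (Real.pi / 7)
  have h4 : Real.cos (3 * (Real.pi / 7)) = -Real.cos (2 * (2 * (Real.pi / 7))) := by
    rw [← Real.cos_pi_sub]; congr 1; ring
  rw [Real.cos_two_mul (2 * (Real.pi / 7)), Real.cos_two_mul (Real.pi / 7), h3] at h4
  have h5 := cos_pos
  have h6 : (Real.cos (Real.pi / 7) + 1) * ((2 * Real.cos (Real.pi / 7)) ^ 3 -
      (2 * Real.cos (Real.pi / 7)) ^ 2 - 2 * (2 * Real.cos (Real.pi / 7)) + 1) = 0 := by
    linear_combination h4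
  exact (mul_eq_zero.1 h6).resolve_left (by positivity)

theorem two_cos_mem_traceField : 2 * Real.cos (Real.pi / 7) ∈ traceField veechGroup := by
  refine IntermediateField.subset_adjoin _ _ ⟨_, rotMatrix_mem exp_pi_div_seven_pow, ?_⟩
  rw [rotMatrix, Matrix.trace_fin_two_of]; ring

theorem fixesDirection_conj {T M : Matrix (Fin 2) (Fin 2) ℝ} (hT : IsUnit T.det)
    {v : Fin 2 → ℝ} (h : FixesDirection M v) : FixesDirection (T * M * T⁻¹) (T.mulVec v) := by
  obtain ⟨hv, c, hc⟩ := h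
  have hinv : T⁻¹.mulVec (T.mulVec v) = v := by
    rw [Matrix.mulVec_mulVec, Matrix.nonsing_inv_mul _ hT, Matrix.one_mulVec]
  refine ⟨fun h0 => hv ?_, c, ?_⟩
  · rw [← hinv, h0, Matrix.mulVec_zero]
  · rw [← Matrix.mulVec_mulVec, hinv, ← Matrix.mulVec_mulVec, hc, Matrix.mulVec_smul]

theorem trace_conj {T M : Matrix (Fin 2) (Fin 2) ℝ} (hT : IsUnit T.det) :
    (T * M * T⁻¹).trace = M.trace := by
  rw [Matrix.trace_mul_cycle, Matrix.nonsing_inv_mul _ hT, Matrix.one_mul]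

end DoubleHeptagon

open DoubleHeptagon in
theorem proposition2 (a : ℝ) (ha : a = 2 * Real.cos (Real.pi / 7))
    (T P L U Q M : Matrix (Fin 2) (Fin 2) ℝ)
    (hT : T = !![Real.cos (Real.pi / 7) + 1, Real.cos (Real.pi / 7) + 1;
      -Real.sin (Real.pi / 7), Real.sin (Real.pi / 7)])
    (hP : P = !![a, 1; a ^ 2 - 1, a])
    (hL : L = !![1, 0; a, 1])
    (hU : U = !![1, a; 0, 1])
    (hQ : Q = !![a, -1; -a ^ 2 + 1, a])
    (hM : M = P * P * L * U * Q * Q) :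
    (∀ A ∈ ({P, L, U, Q} : Set (Matrix (Fin 2) (Fin 2) ℝ)),
      ∃ B ∈ DoubleHeptagon.veechGroup, (B : Matrix (Fin 2) (Fin 2) ℝ) = T * A * T⁻¹) ∧
    M.trace = 2 + a ^ 2 ∧
    (∃ B ∈ DoubleHeptagon.veechGroup, (B : Matrix (Fin 2) (Fin 2) ℝ) = T * M * T⁻¹ ∧
      IsHyperbolicElement B) ∧
    ∃ m₁ ∈ traceField DoubleHeptagon.veechGroup, ∃ m₂ ∈ traceField DoubleHeptagon.veechGroup,
      m₁ ≠ m₂ ∧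
      ∀ m : ℝ, m = m₁ ∨ m = m₂ →
        FixesDirection M ![1, m] ∧
        FixesDirection (T * M * T⁻¹) (T.mulVec ![1, m]) ∧
        IsHyperbolicDirection DoubleHeptagon.veechGroup (T.mulVec ![1, m]) := by
  have hTs : T = staircase := hT
  have hTu : IsUnit T.det := hTs ▸ isUnit_det_staircase
  have hcub : a ^ 3 - a ^ 2 - 2 * a + 1 = 0 := ha ▸ two_cos_cubic
  have hpos : 0 < a := by rw [ha]; linarith [cos_pos]
  have haK : a ∈ traceField veechGroup := ha ▸ two_cos_mem_traceField
  -- With `r` the rotation by `π/7`, `s = r U⁻¹` is the quarter turn of the staircase coordinates,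
  -- and `L = s U⁻¹ s⁻¹`, `P = L U⁻¹ s⁻¹`, `Q = P⁻¹`.
  have cr : ConjMem T !![0, -1; 1, a] := by rw [hTs, ha]; exact conjMem_rotation
  have cU : ConjMem T U := by rw [hTs, hU, ha]; exact conjMem_parabolic
  have cUi : ConjMem T !![1, -a; 0, 1] := cU.inv (by
    rw [hU, Matrix.mul_fin_two, Matrix.one_fin_two]; refine fin_two_congr ?_ ?_ ?_ ?_ <;> ring)
  have cs : ConjMem T !![0, -1; 1, 0] := by
    convert cr.mul cUi using 1
    rw [Matrix.mul_fin_two]; refine fin_two_congr ?_ ?_ ?_ ?_ <;> ring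
  have csi : ConjMem T !![0, 1; -1, 0] := cs.inv (by
    rw [Matrix.mul_fin_two, Matrix.one_fin_two]; refine fin_two_congr ?_ ?_ ?_ ?_ <;> ring)
  have cL : ConjMem T L := by
    convert (cs.mul cUi).mul csi using 1
    rw [hL, Matrix.mul_fin_two, Matrix.mul_fin_two]; refine fin_two_congr ?_ ?_ ?_ ?_ <;> ring
  have cP : ConjMem T P := by
    convert (cL.mul cUi).mul csi using 1
    rw [hP, hL, Matrix.mul_fin_two, Matrix.mul_fin_two]; refine fin_two_congr ?_ ?_ ?_ ?_ <;> ring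
  have cQ : ConjMem T Q := cP.inv (by
    rw [hP, hQ, Matrix.mul_fin_two, Matrix.one_fin_two]; refine fin_two_congr ?_ ?_ ?_ ?_ <;> ring)
  have cM : ConjMem T M := by
    rw [hM]; exact ((((cP.mul cP).mul cL).mul cU).mul cQ).mul cQ
  have hMe : M = !![19 - 26 * a - 34 * a ^ 2, -14 + 21 * a + 22 * a ^ 2;
      28 - 41 * a - 50 * a ^ 2, -17 + 26 * a + 35 * a ^ 2] := by
    rw [hM, hP, hL, hU, hQ]
    simp only [Matrix.mul_fin_two]
    refine fin_two_congr ?_ ?_ ?_ ?_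
    · linear_combination (-18 - 10 * a - 8 * a ^ 2 - 8 * a ^ 3) * hcub
    · linear_combination (14 + 8 * a + 8 * a ^ 2) * hcub
    · linear_combination (-28 - 14 * a - 6 * a ^ 2 - 8 * a ^ 3 - 8 * a ^ 4) * hcub
    · linear_combination (18 + 10 * a + 8 * a ^ 2 + 8 * a ^ 3) * hcub
  have htr : M.trace = 2 + a ^ 2 := by
    rw [hMe, Matrix.trace_fin_two_of]; ring
  obtain ⟨B, hB, hBM⟩ := cM.exists_eq hTu
  have hBh : IsHyperbolicElement B := by
    rw [IsHyperbolicElement, hBM, trace_conj hTu, htr, abs_of_pos (by positivity)]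
    linarith [pow_pos hpos 2]
  refine ⟨?_, htr, ⟨B, hB, hBM, hBh⟩, ?_⟩
  · rintro A (rfl | rfl | rfl | rfl)
    · exact cP.exists_eq hTu
    · exact cL.exists_eq hTu
    · exact cU.exists_eq hTu
    · exact cQ.exists_eq hTu
  -- The eigenvalues of `M` are `2 - a` and `a + a ^ 2`: the discriminant `a ^ 2 * (a ^ 2 + 4)` of
  -- its characteristic polynomial is a square in `ℚ(a)`, as `a ^ 2 + 4 = (2 * a ^ 2 - a - 2) ^ 2`.
  have hmem : ∀ p q r : ℚ, (p + q * a + r * a ^ 2 : ℝ) ∈ traceField veechGroup := fun p q r =>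
    add_mem (add_mem (algebraMap_mem _ p) (mul_mem (algebraMap_mem _ q) haK))
      (mul_mem (algebraMap_mem _ r) (pow_mem haK 2))
  refine ⟨(-41 - a + 19 * a ^ 2) / 13, ?_, (-1 + 6 * a + 3 * a ^ 2) / 13, ?_, ?_, ?_⟩
  · convert hmem (-41 / 13) (-1 / 13) (19 / 13) using 1
    push_cast; ring
  · convert hmem (-1 / 13) (6 / 13) (3 / 13) using 1
    push_cast; ring
  · intro h
    -- the difference of the two slopes is invertible modulo the minimal equation of `a`
    have : (1 : ℝ) = 0 := by
      linear_combination (2 - 3 * a - 5 * a ^ 2) * h - (-93 / 13 - 80 / 13 * a) * hcub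
    exact one_ne_zero this
  · intro m hm
    have hfix : FixesDirection M ![1, m] := by
      refine ⟨fun h => one_ne_zero (congrFun h 0), ?_⟩
      rw [hMe]
      rcases hm with rfl | rfl
      · refine ⟨2 - a, ?_⟩
        ext i
        fin_cases i
        · simp [Matrix.mulVec, dotProduct]
          linear_combination (795 / 13 + 418 / 13 * a) * hcub
        · simp [Matrix.mulVec, dotProduct]
          linear_combination (1143 / 13 + 665 / 13 * a) * hcub
      · refine ⟨a + a ^ 2, ?_⟩
        ext i
        fin_cases i
        · simp [Matrix.mulVec, dotProduct]
          linear_combination (261 / 13 + 66 / 13 * a) * hcub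
        · simp [Matrix.mulVec, dotProduct]
          linear_combination (381 / 13 + 102 / 13 * a) * hcub
    have hfix' := fixesDirection_conj hTu hfix
    exact ⟨hfix, hfix', B, hB, hBh, hBM ▸ hfix'⟩
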